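/- Let $d\ge 1$ and let $(X_1,Y_1),\dots,(X_n,Y_n)$ be i.i.d. random vectors with law $P$ on $\mathbb R^d\times\mathbb R$, and let $Z_1,\dots,Z_m$ be i.i.d. with the law $P^X$ of the covariates, independent of the sample. Assume the following. (a) $P^X$ lives on a measurable set $S_X\subset B(0,\rho_0)$, $\rho_0>0$; there are $c_d,T_0>0$ with $\lambda(S_X\cap B(x,\tau))\ge c_d\,\lambda(B(x,\tau))$ for all $x\in S_X$, $\tau\in(0,T_0]$ ($\lambda$ is Lebesgue measure); and $P^X$ has a density $f_X$ on $S_X$ with $0<b\le f_X\le M<\infty$. (b) The regression function $g(x)=\mathbb E[Y\mid X=x]$ is Lipschitz on $S_X$ for the Euclidean norm. (c) The noise $\varepsilon_i=Y_i-g(X_i)$ is sub-Gaussian with parameter $\sigma^2$ conditionally on $X_i$ and the $Z_j$: its conditional mean is $0$ and the conditional expectation of $e^{t\varepsilon_i}$ is at most $e^{\sigma^2t^2/2}$, for all $t\in\mathbb R$. Let $V_1,\dots,V_m$ be the Voronoi cells in $S_X$ of $Z_1,\dots,Z_m$ (ties broken in favour of the larger index), $\mathcal V(x)$ the cell that contains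 $x\in S_X$, and $$\hat g_{\rm proto}(x)=\frac{\sum_{i=1}^nY_i\mathbf 1_{\mathcal V(x)}(X_i)}{\sum_{i=1}^n\mathbf 1_{\mathcal V(x)}(X_i)}\qquad(0/0=0).$$ For $V\subset S_X$ let $L(V)$ be the smallest constant $K\ge 0$ with $|g(y)-g(y')|\le K\|y-y'\|_2$ for all $y,y'\in V$. Let $V_d$ be the volume of the Euclidean unit ball of $\mathbb R^d$, $\psi_d=(18Md)^d(c_db)^{-d}$, $\delta\in(0,1/5)$ and $c_\delta=\log(1/\delta)/\delta^d$. 1. If $n\ge1$, $m\ge3$, $$\frac nm\ge\frac{8\psi_d\log(1/\delta)}{\delta^d}\quad\text{and}\quad 32d\log(12m/\delta)\le T_0^d\,m\,b\,c_dV_d,$$ then for every $x\in S_X$, with probability at least $1-5\delta$, $$|\hat g_{\rm proto}(x)-g(x)|\le\sqrt{\frac{4\sigma^2\psi_d\log(1/\delta)}{\delta^d}}\sqrt{\frac mn}+2L(\mathcal V(x))\left(\frac{32d\log(12m/\delta)}{m\,b\,c_dV_d}\right)^{1/d}.$$ 2. For all $a_1,a_2>0$ there is a constant $K>0$, depending only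 on $d,a_1,a_2$, such that for all $n\ge N$, where $N$ depends only on $d,a_1,a_2,T_0,c_d,b,M,\delta$, and all integers $m$ with $a_1r_n\le m\le a_2r_n$, where $r_n=(n/c_\delta)^{d/(d+2)}\log(12n/\delta)^{2/(d+2)}$, one has for every $x\in S_X$, with probability at least $1-5\delta$, $$|\hat g_{\rm proto}(x)-g(x)|\le K\left(\sqrt{4\sigma^2\psi_d}+2L(\mathcal V(x))\left(\frac{32d}{b\,c_dV_d}\right)^{1/d}\right)\left(\frac{c_\delta\log(12n/\delta)}{n}\right)^{1/(d+2)}.$$ -/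

import Mathlib

open MeasureTheory ProbabilityTheory Set
open scoped ENNReal NNReal

namespace ProtoNN

noncomputable section

/-- The covariate space `ℝ^d` with its Euclidean norm. -/
abbrev Cov (d : ℕ) : Type := EuclideanSpace ℝ (Fin d)

/-- `V_d`, the Lebesgue volume of the Euclidean unit ball of `ℝ^d`. -/
def unitBallVol (d : ℕ) : ℝ := (volume : Measure (Cov d)).real (Metric.ball 0 1)

/-- `ψ_d = (18 M d)^d (c_d b)^{-d}`. -/
def psi (d : ℕ) (M c b : ℝ) : ℝ := (18 * M * d) ^ d * ((c * b) ^ d)⁻¹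

/-- `c_δ = log(1/δ) / δ^d`. -/
def cDelta (d : ℕ) (δ : ℝ) : ℝ := Real.log (1 / δ) / δ ^ d

/-! ### The estimator -/

open Classical in
/-- The index of the nearest neighbour of `x` among `z 0, …, z (m - 1)`, ties being broken in favour
of the larger index. The value `⊥` occurs only when `m = 0`, see `nearestIndex_ne_bot`. -/
def nearestIndex {d m : ℕ} (z : Fin m → Cov d) (x : Cov d) : WithBot (Fin m) :=
  (Finset.univ.filter fun k : Fin m => ∀ j : Fin m, dist x (z k) ≤ dist x (z j)).max

theorem nearestIndex_ne_bot {d m : ℕ} (hm : 0 < m) (z : Fin m → Cov d) (x : Cov d) :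
    nearestIndex z x ≠ ⊥ := by
  classical
  obtain ⟨k, -, hk⟩ := Finset.exists_min_image (Finset.univ : Finset (Fin m))
    (fun k => dist x (z k)) ⟨⟨0, hm⟩, Finset.mem_univ _⟩
  intro h
  rw [nearestIndex, Finset.max_eq_bot] at h
  have hk' : k ∈ Finset.univ.filter
      (fun k : Fin m => ∀ j : Fin m, dist x (z k) ≤ dist x (z j)) :=
    Finset.mem_filter.mpr ⟨Finset.mem_univ _, fun j => hk j (Finset.mem_univ _)⟩
  exact absurd hk' (by convert Finset.notMem_empty k)

/-- The Voronoi cell, inside `S`, of the prototype `z k`. -/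
def voronoiCell {d m : ℕ} (S : Set (Cov d)) (z : Fin m → Cov d) (k : Fin m) : Set (Cov d) :=
  {y | y ∈ S ∧ nearestIndex z y = (k : WithBot (Fin m))}

/-- The local map `𝒱(x)`: the Voronoi cell that contains `x`. -/
def localCell {d m : ℕ} (S : Set (Cov d)) (z : Fin m → Cov d) (x : Cov d) : Set (Cov d) :=
  ⋃ k ∈ {k : Fin m | nearestIndex z x = (k : WithBot (Fin m))}, voronoiCell S z k

/-- The Proto-NN prediction at `x`: the average of the `y i` over the `x i` that fall in the Voronoi
cell of `x` (with `0 / 0 = 0`). -/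
def protoNN {d m n : ℕ} (S : Set (Cov d)) (z : Fin m → Cov d) (xs : Fin n → Cov d)
    (ys : Fin n → ℝ) (x : Cov d) : ℝ :=
  (∑ i, (localCell S z x).indicator (fun _ => ys i) (xs i)) /
    (∑ i, (localCell S z x).indicator (fun _ => (1 : ℝ)) (xs i))

/-- The local Lipschitz constant `L(V)` of `g` over `V`. -/
def localLip {d : ℕ} (g : Cov d → ℝ) (V : Set (Cov d)) : ℝ :=
  sInf {K : ℝ | 0 ≤ K ∧ ∀ x ∈ V, ∀ y ∈ V, |g x - g y| ≤ K * ‖x - y‖}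

/-! ### The assumptions -/

/-- `g` is a version of the regression function `x ↦ E[Y | X = x]`, where `(X, Y) ∼ P`. -/
structure IsRegressionFunction {d : ℕ} (P : Measure (Cov d × ℝ)) (g : Cov d → ℝ) : Prop where
  integrable : Integrable (fun p : Cov d × ℝ => p.2) P
  condExp_eq : P[fun p : Cov d × ℝ => p.2 | MeasurableSpace.comap Prod.fst inferInstance]
    =ᵐ[P] fun p => g p.1

/-- The real random variable `ε` is sub-Gaussian with parameter `σ²` conditionally on the
sub-`σ`-algebra `𝓖`. -/
structure IsCondSubGaussian {Ω : Type*} [mΩ : MeasurableSpace Ω] (μ : Measure Ω)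
    (𝓖 : MeasurableSpace Ω) (ε : Ω → ℝ) (σ : ℝ) : Prop where
  integrable : Integrable ε μ
  condExp_eq_zero : μ[ε | 𝓖] =ᵐ[μ] 0
  integrable_exp : ∀ t : ℝ, Integrable (fun ω => Real.exp (t * ε ω)) μ
  condExp_exp_le : ∀ t : ℝ, ∀ᵐ ω ∂μ,
    (μ[fun ω => Real.exp (t * ε ω) | 𝓖]) ω ≤ Real.exp (σ ^ 2 * t ^ 2 / 2)

/-- The law `Q` of the covariates lives on the bounded set `S`, whose boundary is regular, with a
density on `S` that takes its values in `[b, M]`. -/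
structure IsRegularLaw {d : ℕ} (Q : Measure (Cov d)) (S : Set (Cov d)) (ρ₀ T₀ c b M : ℝ) :
    Prop where
  measurableSet : MeasurableSet S
  rho_pos : 0 < ρ₀
  T_pos : 0 < T₀
  c_pos : 0 < c
  b_pos : 0 < b
  b_le_M : b ≤ M
  subset_ball : S ⊆ Metric.closedBall 0 ρ₀
  volume_inter_ball : ∀ x ∈ S, ∀ τ : ℝ, 0 < τ → τ ≤ T₀ →
    ENNReal.ofReal c * volume (Metric.closedBall x τ) ≤ volume (S ∩ Metric.closedBall x τ)
  density : ∃ f : Cov d → ℝ, Measurable f ∧ (∀ x ∈ S, b ≤ f x ∧ f x ≤ M) ∧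
    Q = (volume.restrict S).withDensity fun x => ENNReal.ofReal (f x)

/-- The setting of Proto-NN: an i.i.d. sample `(X i, Y i)` of law `P`, and, independent of it, i.i.d.
prototypes `Z j` with the law of the covariates; a Lipschitz regression function `g`; a noise
`Y i - g (X i)` which is sub-Gaussian conditionally on the covariate and the prototypes. -/
structure Setting {Ω : Type*} [MeasurableSpace Ω] (μ : Measure Ω) {d n m : ℕ}
    (P : Measure (Cov d × ℝ)) (S : Set (Cov d)) (g : Cov d → ℝ)
    (X : Fin n → Ω → Cov d) (Y : Fin n → Ω → ℝ) (Z : Fin m → Ω → Cov d)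
    (L : ℝ≥0) (σ ρ₀ T₀ c b M : ℝ) : Prop where
  measurable_X : ∀ i, Measurable (X i)
  measurable_Y : ∀ i, Measurable (Y i)
  measurable_Z : ∀ j, Measurable (Z j)
  law_XY : ∀ i, μ.map (fun ω => (X i ω, Y i ω)) = P
  indep_XY : iIndepFun (fun i ω => (X i ω, Y i ω)) μ
  law_Z : ∀ j, μ.map (Z j) = P.map Prod.fst
  indep_Z : iIndepFun Z μ
  indep_XY_Z : IndepFun (fun ω i => (X i ω, Y i ω)) (fun ω j => Z j ω) μ
  regularLaw : IsRegularLaw (P.map Prod.fst) S ρ₀ T₀ c b M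
  regression : IsRegressionFunction P g
  lipschitz : LipschitzOnWith L g S
  subGaussian : ∀ i, IsCondSubGaussian μ
    (MeasurableSpace.comap (fun ω => (X i ω, fun j => Z j ω)) inferInstance)
    (fun ω => Y i ω - g (X i ω)) σ

end

end ProtoNN

namespace ProtoNN

/-! ### Volumes of balls and masses under a regular law -/

/-! Since the prototypes are independent of the sample, their joint law is a product
(`Setting.map_eq`) and the prototypes can be frozen: the cell `V` of `x` becomes a fixed set. On `V`
the error splits into an average of noise and a bias (`abs_protoNN_sub_le`), and five events of
probability at most `δ` have to be excluded.

Bias: if every point of `S` has a prototype within `τ = coverRadius`, then every point of `V` is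
within `2τ` of `x`. This can fail only if some point of a `τ/(2d)`-net of `S` has no prototype
within `τ - τ/(2d)`, and a union bound over the net makes that unlikely (`measure_not_covered_le`).

Mass of the cell: if the prototype nearest to `x` is at distance more than `2s` from the others, its
cell contains the part of `S` in the `s`-ball around it. Asking all pairs of prototypes to be
separated would cost a factor `m²`. Here only the neighbours of one prototype matter: when `z j` is
removed, the nearest prototype of `x` remains nearest, and `z j` is independent of it. So `m` terms
suffice (`measure_exists_dist_nearest_le`), and `V` has mass at least `p₀ = δ^d / (ψ_d m)`
(`measure_localCell_lt_le`).

Noise: a Chernoff bound gives at least `n p₀ / 2` sample points in `V` (`measure_hits_lt_le`). If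
`N` is their number, the noise sum is at most `√(2σ² N log(1/δ))` in absolute value, one event for
each sign (`measure_sqrt_lt_sumOver_le`). Dividing by `N ≥ n p₀ / 2` gives the first term of the
bound.

Rate: with `u = c_δ log(12n/δ) / n`, the prescribed order of `m` is `(n / c_δ) u^(2/(d+2))`, which
makes both terms of order `u^(1/(d+2))`. -/

theorem unitBallVol_pos (d : ℕ) : 0 < unitBallVol d :=
  ENNReal.toReal_pos (Metric.measure_ball_pos _ _ one_pos).ne' measure_ball_lt_top.ne

theorem volume_closedBall_eq {d : ℕ} (x : Cov d) {r : ℝ} (hr : 0 ≤ r) :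
    volume (Metric.closedBall x r) = ENNReal.ofReal (unitBallVol d * r ^ d) := by
  rw [Measure.addHaar_closedBall _ _ hr, finrank_euclideanSpace_fin, mul_comm (unitBallVol d),
    ENNReal.ofReal_mul (by positivity), unitBallVol, measureReal_def,
    ENNReal.ofReal_toReal measure_ball_lt_top.ne]

namespace IsRegularLaw

variable {d : ℕ} {Q : Measure (Cov d)} {S : Set (Cov d)} {ρ₀ T₀ c b M : ℝ}

theorem measure_compl_eq_zero (h : IsRegularLaw Q S ρ₀ T₀ c b M) : Q Sᶜ = 0 := by
  obtain ⟨f, hf, hfS, rfl⟩ := h.density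
  apply withDensity_absolutelyContinuous
  rw [Measure.restrict_apply h.measurableSet.compl]
  simp

theorem M_pos (h : IsRegularLaw Q S ρ₀ T₀ c b M) : 0 < M := h.b_pos.trans_le h.b_le_M

theorem le_measure_inter_closedBall (h : IsRegularLaw Q S ρ₀ T₀ c b M) {z : Cov d} (hz : z ∈ S)
    {τ : ℝ} (hτ : 0 < τ) (hτT : τ ≤ T₀) :
    ENNReal.ofReal (b * c * unitBallVol d * τ ^ d) ≤ Q (S ∩ Metric.closedBall z τ) := by
  obtain ⟨f, hf, hfS, rfl⟩ := h.density
  have hB : MeasurableSet (S ∩ Metric.closedBall z τ) :=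
    h.measurableSet.inter Metric.isClosed_closedBall.measurableSet
  rw [withDensity_apply _ hB, Measure.restrict_restrict hB]
  have hset : S ∩ Metric.closedBall z τ ∩ S = S ∩ Metric.closedBall z τ := by
    ext; simp only [mem_inter_iff]; tauto
  rw [hset]
  calc ENNReal.ofReal (b * c * unitBallVol d * τ ^ d)
      = ENNReal.ofReal b * (ENNReal.ofReal c * volume (Metric.closedBall z τ)) := by
        rw [volume_closedBall_eq z hτ.le, ← ENNReal.ofReal_mul h.c_pos.le,
          ← ENNReal.ofReal_mul h.b_pos.le]
        ring_nf
    _ ≤ ENNReal.ofReal b * volume (S ∩ Metric.closedBall z τ) := by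
        gcongr
        exact h.volume_inter_ball z hz τ hτ hτT
    _ = ∫⁻ _ in S ∩ Metric.closedBall z τ, ENNReal.ofReal b := by rw [setLIntegral_const]
    _ ≤ _ := setLIntegral_mono' hB fun y hy => ENNReal.ofReal_le_ofReal (hfS y hy.1).1

theorem measure_closedBall_le (h : IsRegularLaw Q S ρ₀ T₀ c b M) (w : Cov d) {t : ℝ}
    (ht : 0 ≤ t) :
    Q (Metric.closedBall w t) ≤ ENNReal.ofReal (M * unitBallVol d * t ^ d) := by
  obtain ⟨f, hf, hfS, rfl⟩ := h.density
  have hB : MeasurableSet (Metric.closedBall w t) := Metric.isClosed_closedBall.measurableSet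
  rw [withDensity_apply _ hB, Measure.restrict_restrict hB]
  calc _ ≤ ∫⁻ _ in Metric.closedBall w t ∩ S, ENNReal.ofReal M :=
        setLIntegral_mono' (hB.inter h.measurableSet)
          fun y hy => ENNReal.ofReal_le_ofReal (hfS y hy.2).2
    _ = ENNReal.ofReal M * volume (Metric.closedBall w t ∩ S) := by rw [setLIntegral_const]
    _ ≤ ENNReal.ofReal M * volume (Metric.closedBall w t) := by gcongr; exact inter_subset_left
    _ = _ := by
        rw [volume_closedBall_eq w ht, ← ENNReal.ofReal_mul h.M_pos.le, mul_assoc]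

/-- Compare volumes at the scale `T₀`. Together with `b ≤ M` this gives `c b / M ≤ 1`, which is
needed to bound `cellMass`. -/
theorem c_le_one (h : IsRegularLaw Q S ρ₀ T₀ c b M) (hS : S.Nonempty) : c ≤ 1 := by
  obtain ⟨x, hx⟩ := hS
  have h1 := (h.volume_inter_ball x hx T₀ h.T_pos le_rfl).trans (measure_mono inter_subset_right)
  have hpos : 0 < unitBallVol d * T₀ ^ d := mul_pos (unitBallVol_pos d) (pow_pos h.T_pos d)
  rw [volume_closedBall_eq x h.T_pos.le, ← ENNReal.ofReal_mul h.c_pos.le,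
    ENNReal.ofReal_le_ofReal_iff hpos.le] at h1
  exact le_of_mul_le_mul_right (by linarith) hpos

end IsRegularLaw

/-! ### Nearest neighbours and Voronoi cells -/

theorem nearestIndex_eq_coe_iff {d m : ℕ} (z : Fin m → Cov d) (y : Cov d) (k : Fin m) :
    nearestIndex z y = (k : WithBot (Fin m)) ↔
      (∀ j, dist y (z k) ≤ dist y (z j)) ∧
        ∀ j, (∀ i, dist y (z j) ≤ dist y (z i)) → j ≤ k := by
  classical
  unfold nearestIndex
  constructor
  · intro h
    refine ⟨(Finset.mem_filter.1 (Finset.mem_of_max h)).2, fun j hj => ?_⟩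
    exact Finset.le_max_of_eq (Finset.mem_filter.2 ⟨Finset.mem_univ _, hj⟩) h
  · rintro ⟨h1, h2⟩
    refine le_antisymm (Finset.max_le fun j hj => ?_)
      (Finset.le_max (Finset.mem_filter.2 ⟨Finset.mem_univ _, h1⟩))
    exact WithBot.coe_le_coe.2 (h2 j (Finset.mem_filter.1 hj).2)

theorem exists_nearestIndex_eq {d m : ℕ} (hm : 0 < m) (z : Fin m → Cov d) (y : Cov d) :
    ∃ k : Fin m, nearestIndex z y = (k : WithBot (Fin m)) :=
  ⟨_, (WithBot.coe_unbot _ (nearestIndex_ne_bot hm z y)).symm⟩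

theorem mem_localCell_iff {d m : ℕ} {S : Set (Cov d)} {z : Fin m → Cov d} {x y : Cov d} :
    y ∈ localCell S z x ↔ y ∈ S ∧ ∃ k : Fin m, nearestIndex z x = (k : WithBot (Fin m)) ∧
      nearestIndex z y = (k : WithBot (Fin m)) := by
  simp only [localCell, voronoiCell, mem_iUnion, mem_ofPred_eq, exists_prop]
  tauto

theorem localCell_subset {d m : ℕ} {S : Set (Cov d)} {z : Fin m → Cov d} {x : Cov d} :
    localCell S z x ⊆ S := fun _ hy => (mem_localCell_iff.1 hy).1

theorem self_mem_localCell {d m : ℕ} (hm : 0 < m) {S : Set (Cov d)} {z : Fin m → Cov d}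
    {x : Cov d} (hx : x ∈ S) : x ∈ localCell S z x := by
  obtain ⟨k, hk⟩ := exists_nearestIndex_eq hm z x
  exact mem_localCell_iff.2 ⟨hx, k, hk, hk⟩

theorem measurableSet_nearestIndex_eq {d m : ℕ} (k : Fin m) :
    MeasurableSet {q : (Fin m → Cov d) × Cov d |
      nearestIndex q.1 q.2 = (k : WithBot (Fin m))} := by
  simp only [nearestIndex_eq_coe_iff]
  have hle : ∀ i j : Fin m, MeasurableSet {q : (Fin m → Cov d) × Cov d |
      dist q.2 (q.1 i) ≤ dist q.2 (q.1 j)} := fun i j =>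
    measurableSet_le (measurable_snd.dist ((measurable_pi_apply i).comp measurable_fst))
      (measurable_snd.dist ((measurable_pi_apply j).comp measurable_fst))
  have hall : ∀ i : Fin m, Measurable fun q : (Fin m → Cov d) × Cov d =>
      ∀ j, dist q.2 (q.1 i) ≤ dist q.2 (q.1 j) := fun i =>
    Measurable.forall fun j => measurableSet_setOfPred.1 (hle i j)
  exact measurableSet_setOfPred.2
    ((hall k).and (Measurable.forall fun j => (hall j).imp measurable_const))

theorem measurableSet_nearestIndex_eq_left {d m : ℕ} (x : Cov d) (k : Fin m) :
    MeasurableSet {z : Fin m → Cov d | nearestIndex z x = (k : WithBot (Fin m))} :=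
  measurable_prodMk_right (y := x) (measurableSet_nearestIndex_eq k)

/-- Joint measurability in the prototypes and the point is what allows Fubini once the prototypes
are frozen. -/
theorem measurableSet_mem_localCell {d m : ℕ} {S : Set (Cov d)} (hS : MeasurableSet S)
    (x : Cov d) :
    MeasurableSet {q : (Fin m → Cov d) × Cov d | q.2 ∈ localCell S q.1 x} := by
  simp only [mem_localCell_iff]
  refine measurableSet_setOfPred.2 (Measurable.and (measurableSet_setOfPred.1 (measurable_snd hS))
    (Measurable.exists fun k => Measurable.and ?_ ?_))
  · exact measurableSet_setOfPred.1 (measurable_fst (measurableSet_nearestIndex_eq_left x k))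
  · exact measurableSet_setOfPred.1 (measurableSet_nearestIndex_eq k)

/-- A prototype which is at distance more than `2 r` from all others captures its `r`-ball. -/
theorem inter_closedBall_subset_localCell {d m : ℕ} {S : Set (Cov d)} {z : Fin m → Cov d}
    {x : Cov d} {k : Fin m} (hk : nearestIndex z x = (k : WithBot (Fin m))) {r : ℝ}
    (hsep : ∀ j, j ≠ k → 2 * r < dist (z j) (z k)) :
    S ∩ Metric.closedBall (z k) r ⊆ localCell S z x := by
  rintro y ⟨hyS, hy⟩
  rw [Metric.mem_closedBall] at hy
  have hlt : ∀ j, j ≠ k → dist y (z k) < dist y (z j) := fun j hj => by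
    have h1 := hsep j hj
    have h2 := dist_triangle_left (z j) (z k) y
    linarith
  refine mem_localCell_iff.2 ⟨hyS, k, hk, (nearestIndex_eq_coe_iff _ _ _).2 ⟨fun j => ?_, ?_⟩⟩
  · rcases eq_or_ne j k with rfl | hj
    exacts [le_rfl, (hlt j hj).le]
  · intro j hj
    by_contra hjk
    exact absurd (hj k) (not_le.2 (hlt j (fun e => hjk e.le)))

/-- If every point of `S` is within `τ` of some prototype, then two points in the same cell are
within `2 τ` of each other. -/
theorem dist_le_of_mem_localCell {d m : ℕ} {S : Set (Cov d)} {z : Fin m → Cov d} {x y : Cov d}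
    {τ : ℝ} (hx : x ∈ S) (hcov : ∀ y ∈ S, ∃ j, dist y (z j) ≤ τ) (hy : y ∈ localCell S z x) :
    dist y x ≤ 2 * τ := by
  obtain ⟨hyS, k, hxk, hyk⟩ := mem_localCell_iff.1 hy
  obtain ⟨i, hi⟩ := hcov x hx
  obtain ⟨j, hj⟩ := hcov y hyS
  have h1 := ((nearestIndex_eq_coe_iff _ _ _).1 hxk).1 i
  have h2 := ((nearestIndex_eq_coe_iff _ _ _).1 hyk).1 j
  have h3 := dist_triangle_right y x (z k)
  linarith

/-! ### The local Lipschitz constant -/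

theorem localLip_nonneg {d : ℕ} (g : Cov d → ℝ) (V : Set (Cov d)) : 0 ≤ localLip g V :=
  Real.sInf_nonneg fun _ h => h.1

theorem abs_sub_le_localLip_mul {d : ℕ} {g : Cov d → ℝ} {S V : Set (Cov d)} {L : ℝ≥0}
    (hg : LipschitzOnWith L g S) (hV : V ⊆ S) {x y : Cov d} (hx : x ∈ V) (hy : y ∈ V) :
    |g x - g y| ≤ localLip g V * ‖x - y‖ := by
  rcases eq_or_ne x y with rfl | hxy
  · simp
  have hpos : 0 < ‖x - y‖ := norm_pos_iff.2 (sub_ne_zero.2 hxy)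
  rw [← div_le_iff₀ hpos]
  -- The global constant `L` shows that the set of admissible constants is nonempty, so its `sInf`
  -- is not the default value `0`.
  refine le_csInf ⟨L, L.2, fun u hu v hv => ?_⟩ fun K hK => ?_
  · simpa [Real.dist_eq, dist_eq_norm] using hg.dist_le_mul u (hV hu) v (hV hv)
  · rw [div_le_iff₀ hpos]
    exact hK.2 x hx y hy

/-! ### The prototype of a point is well separated from the other prototypes -/

/-- Deleting a prototype other than the nearest one changes nothing: the minimal distance is the
same, and `succAbove` is increasing, so ties are still broken in the same way. -/
theorem nearestIndex_comp_succAbove {d m : ℕ} {z : Fin (m + 1) → Cov d} {x : Cov d}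
    {j : Fin (m + 1)} {k : Fin m}
    (hk : nearestIndex z x = (j.succAbove k : WithBot (Fin (m + 1)))) :
    nearestIndex (fun i => z (j.succAbove i)) x = (k : WithBot (Fin m)) := by
  obtain ⟨h1, h2⟩ := (nearestIndex_eq_coe_iff _ _ _).1 hk
  refine (nearestIndex_eq_coe_iff _ _ _).2 ⟨fun i => h1 _, fun i hi => ?_⟩
  refine (Fin.strictMono_succAbove j).le_iff_le.1 (h2 _ fun l => ?_)
  exact (hi k).trans (h1 l)

/-- If all `t`-balls have mass at most `q`, then the nearest prototype of `x` has another prototype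
within distance `t` with probability at most `m q`. -/
theorem measure_exists_dist_nearest_le {d m : ℕ} (Q : Measure (Cov d)) [IsProbabilityMeasure Q]
    (x : Cov d) {t : ℝ} {q : ℝ≥0∞} (hq : ∀ w, Q (Metric.closedBall w t) ≤ q) :
    Measure.pi (fun _ : Fin m => Q) {z | ∃ k j : Fin m,
      nearestIndex z x = (k : WithBot (Fin m)) ∧ j ≠ k ∧ dist (z j) (z k) ≤ t} ≤ m * q := by
  obtain _ | m := m
  · have : {z : Fin 0 → Cov d | ∃ k j : Fin 0, nearestIndex z x = (k : WithBot (Fin 0)) ∧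
      j ≠ k ∧ dist (z j) (z k) ≤ t} = ∅ := by
      ext z; simp
    rw [this]; simp
  -- The first coordinate is the deleted prototype, the second the family of the remaining ones.
  -- Given the latter, the nearest prototype is a fixed centre, and the slice is contained in one
  -- `t`-ball.
  let B : Fin (m + 1) → Set (Cov d × (Fin m → Cov d)) := fun _ =>
    {p | ∃ k : Fin m, nearestIndex p.2 x = (k : WithBot (Fin m)) ∧ dist p.1 (p.2 k) ≤ t}
  have hBm : ∀ j, MeasurableSet (B j) := fun j => by
    refine measurableSet_setOfPred.2 (Measurable.exists fun k => Measurable.and ?_ ?_)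
    · exact measurableSet_setOfPred.1 (measurable_snd (measurableSet_nearestIndex_eq_left x k))
    · exact measurableSet_setOfPred.1 (measurableSet_le
        (measurable_fst.dist ((measurable_pi_apply k).comp measurable_snd)) measurable_const)
  have hB : ∀ j, Q.prod (Measure.pi fun _ : Fin m => Q) (B j) ≤ q := fun j => by
    rw [Measure.prod_apply_symm (hBm j)]
    calc _ ≤ ∫⁻ _, q ∂(Measure.pi fun _ : Fin m => Q) := by
          refine lintegral_mono fun w => ?_
          by_cases hw : ∃ k : Fin m, nearestIndex w x = (k : WithBot (Fin m))
          · obtain ⟨k, hk⟩ := hw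
            refine (measure_mono ?_).trans (hq (w k))
            rintro a ⟨k', hk', ha⟩
            obtain rfl : k = k' := WithBot.coe_injective (hk.symm.trans hk')
            exact ha
          · have : (fun a => (a, w)) ⁻¹' B j = ∅ := by
              ext a
              simp only [mem_preimage, mem_empty_iff_false, iff_false]
              rintro ⟨k, hk, -⟩
              exact hw ⟨k, hk⟩
            simp [this]
      _ = q := by simp
  have hsub : {z : Fin (m + 1) → Cov d | ∃ k j : Fin (m + 1),
      nearestIndex z x = (k : WithBot (Fin (m + 1))) ∧ j ≠ k ∧ dist (z j) (z k) ≤ t} ⊆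
      ⋃ j, MeasurableEquiv.piFinSuccAbove (fun _ => Cov d) j ⁻¹' B j := by
    rintro z ⟨k, j, hk, hjk, hd⟩
    obtain ⟨k', rfl⟩ := Fin.exists_succAbove_eq hjk.symm
    exact mem_iUnion.2 ⟨j, k', nearestIndex_comp_succAbove hk, hd⟩
  calc _ ≤ ∑ j, Measure.pi (fun _ : Fin (m + 1) => Q)
        (MeasurableEquiv.piFinSuccAbove (fun _ => Cov d) j ⁻¹' B j) :=
        (measure_mono hsub).trans (measure_iUnion_fintype_le _ _)
    _ ≤ ∑ _j : Fin (m + 1), q := by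
        refine Finset.sum_le_sum fun j _ => ?_
        rw [(measurePreserving_piFinSuccAbove (fun _ : Fin (m + 1) => Q) j).measure_preimage
          (hBm j).nullMeasurableSet]
        exact hB j
    _ = _ := by simp

/-! ### The prototypes are dense -/

/-- A maximal `r`-separated subset of `S`. -/
theorem exists_finset_cover {d : ℕ} (Q : Measure (Cov d)) [IsProbabilityMeasure Q]
    {S : Set (Cov d)} {r p : ℝ} (hp : 0 < p)
    (hball : ∀ y ∈ S, ENNReal.ofReal p ≤ Q (Metric.closedBall y (r / 2))) :
    ∃ T : Finset (Cov d), ↑T ⊆ S ∧ (T.card : ℝ) * p ≤ 1 ∧ ∀ y ∈ S, ∃ u ∈ T, dist y u ≤ r := by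
  classical
  -- The possible cardinalities of `r`-separated sets. The balls of radius `r / 2` are disjoint and
  -- each has mass at least `p`, so `A` is bounded and its supremum is attained.
  let A : Set ℕ := {k | ∃ T : Finset (Cov d), T.card = k ∧ ↑T ⊆ S ∧
    ∀ u ∈ T, ∀ v ∈ T, u ≠ v → r < dist u v}
  have hcard : ∀ T : Finset (Cov d), ↑T ⊆ S → (∀ u ∈ T, ∀ v ∈ T, u ≠ v → r < dist u v) →
      (T.card : ℝ) * p ≤ 1 := by
    intro T hTS hT
    have hdisj : (T : Set (Cov d)).PairwiseDisjoint fun u => Metric.closedBall u (r / 2) :=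
      fun u hu v hv huv => Metric.closedBall_disjoint_closedBall (by
        have := hT u hu v hv huv; linarith)
    have h1 : ∑ u ∈ T, ENNReal.ofReal p ≤ 1 := by
      calc ∑ u ∈ T, ENNReal.ofReal p ≤ ∑ u ∈ T, Q (Metric.closedBall u (r / 2)) :=
            Finset.sum_le_sum fun u hu => hball u (hTS hu)
        _ = Q (⋃ u ∈ T, Metric.closedBall u (r / 2)) :=
            (measure_biUnion_finset hdisj fun _ _ => Metric.isClosed_closedBall.measurableSet).symm
        _ ≤ 1 := prob_le_one
    rwa [← ENNReal.ofReal_sum_of_nonneg fun _ _ => hp.le, ENNReal.ofReal_le_one,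
      Finset.sum_const, nsmul_eq_mul] at h1
  have hne : A.Nonempty := ⟨0, ∅, by simp⟩
  have hbdd : BddAbove A := by
    refine ⟨⌊1 / p⌋₊, ?_⟩
    rintro k ⟨T, rfl, hTS, hT⟩
    exact Nat.le_floor ((le_div_iff₀ hp).2 (hcard T hTS hT))
  obtain ⟨T, hTc, hTS, hT⟩ := Nat.sSup_mem hne hbdd
  refine ⟨T, hTS, hcard T hTS hT, fun y hy => ?_⟩
  by_contra! hfar
  -- The sign of `r` is not assumed. Here `y ∈ T` would force `r < 0`, and then a ball of mass at
  -- least `p > 0` would be empty.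
  have hyT : y ∉ T := fun h => by
    have h1 := hfar y h
    have h2 := hball y hy
    rw [dist_self] at h1
    rw [Metric.closedBall_eq_empty.2 (by linarith), measure_empty, nonpos_iff_eq_zero,
      ENNReal.ofReal_eq_zero] at h2
    linarith
  have hmem : T.card + 1 ∈ A := by
    refine ⟨insert y T, Finset.card_insert_of_notMem hyT, ?_, ?_⟩
    · rw [Finset.coe_insert]
      exact insert_subset hy hTS
    · intro u hu v hv huv
      rcases Finset.mem_insert.1 hu with hu' | hu' <;>
        rcases Finset.mem_insert.1 hv with hv' | hv'
      · exact absurd (hu'.trans hv'.symm) huv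
      · exact hu' ▸ hfar v hv'
      · rw [dist_comm]; exact hv' ▸ hfar u hu'
      · exact hT u hu' v hv' huv
  have := le_csSup hbdd hmem
  omega

theorem measure_exists_notMem_closedBall_le {d m : ℕ} (Q : Measure (Cov d))
    [IsProbabilityMeasure Q] (T : Finset (Cov d)) {s p : ℝ}
    (hT : ∀ u ∈ T, ENNReal.ofReal p ≤ Q (Metric.closedBall u s)) :
    Measure.pi (fun _ : Fin m => Q) {z | ∃ u ∈ T, ∀ j, s < dist u (z j)} ≤
      ENNReal.ofReal (T.card * Real.exp (-(m * p))) := by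
  have hsub : {z : Fin m → Cov d | ∃ u ∈ T, ∀ j, s < dist u (z j)} ⊆
      ⋃ u ∈ T, univ.pi fun _ : Fin m => (Metric.closedBall u s)ᶜ := by
    rintro z ⟨u, hu, hz⟩
    refine mem_iUnion₂.2 ⟨u, hu, fun j _ => ?_⟩
    simpa [dist_comm] using hz j
  calc _ ≤ ∑ u ∈ T, Measure.pi (fun _ : Fin m => Q)
        (univ.pi fun _ : Fin m => (Metric.closedBall u s)ᶜ) :=
        (measure_mono hsub).trans (measure_biUnion_finset_le _ _)
    _ ≤ ∑ u ∈ T, ENNReal.ofReal (Real.exp (-(m * p))) := by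
        refine Finset.sum_le_sum fun u hu => ?_
        rw [Measure.pi_pi, Finset.prod_const, Finset.card_univ, Fintype.card_fin,
          prob_compl_eq_one_sub Metric.isClosed_closedBall.measurableSet]
        calc _ ≤ (ENNReal.ofReal (Real.exp (-p))) ^ m := by
              gcongr
              calc 1 - Q (Metric.closedBall u s) ≤ 1 - ENNReal.ofReal p :=
                    tsub_le_tsub_left (hT u hu) _
                _ ≤ ENNReal.ofReal (1 - p) := by
                    rw [tsub_le_iff_right, ← ENNReal.ofReal_one]
                    calc ENNReal.ofReal 1 = ENNReal.ofReal ((1 - p) + p) := by ring_nf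
                      _ ≤ _ := ENNReal.ofReal_add_le
                _ ≤ _ := ENNReal.ofReal_le_ofReal (by linarith [Real.add_one_le_exp (-p)])
          _ = _ := by
              rw [← ENNReal.ofReal_pow (Real.exp_pos _).le, ← Real.exp_nat_mul]
              ring_nf
    _ = _ := by
        rw [Finset.sum_const, nsmul_eq_mul, ENNReal.ofReal_mul (by positivity),
          ENNReal.ofReal_natCast]

theorem one_le_log_of_three_le {m δ : ℝ} (hm : 3 ≤ m) (hδ : 0 < δ) (hδ1 : δ ≤ 1) :
    1 ≤ Real.log (12 * m / δ) := by
  rw [Real.le_log_iff_exp_le (by positivity), le_div_iff₀ hδ]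
  nlinarith [Real.exp_one_lt_d9, Real.exp_pos 1]

/-- The exponential is at most `(δ / (12 m))^(2d)`, while `4 d ≤ m` bounds the size of the net by
`m^(2d)`. The powers of `m` cancel. -/
theorem card_mul_exp_le {d m : ℕ} (hd : 1 ≤ d) (hm : 3 ≤ m) {δ N q : ℝ} (hδ : 0 < δ)
    (hδ1 : δ ≤ 1) (hmd : 4 * (d : ℝ) ≤ m) (hN : N ≤ (4 * d : ℝ) ^ d * m)
    (hq : 16 * d * Real.log (12 * m / δ) ≤ q) : N * Real.exp (-q) ≤ δ := by
  have hm0 : (3 : ℝ) ≤ m := by exact_mod_cast hm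
  have hmpos : (0 : ℝ) < m := by linarith
  have hexp : Real.exp (-q) ≤ (δ / (12 * m)) ^ (2 * d) := by
    calc Real.exp (-q) ≤ Real.exp (-(16 * d * Real.log (12 * m / δ))) := by gcongr
      _ = (δ / (12 * m)) ^ (16 * d) := by
          rw [← Real.exp_log (show (0 : ℝ) < δ / (12 * m) by positivity), ← Real.exp_nat_mul,
            ← inv_div (12 * (m : ℝ)) δ, Real.log_inv]
          push_cast; ring_nf
      _ ≤ (δ / (12 * m)) ^ (2 * d) := by
          refine pow_le_pow_of_le_one (by positivity) ?_ (by omega)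
          rw [div_le_one (by positivity)]; linarith
  have hN' : N ≤ (m : ℝ) ^ (2 * d) := by
    calc N ≤ (4 * d : ℝ) ^ d * m := hN
      _ ≤ (m : ℝ) ^ d * (m : ℝ) ^ d := by
          gcongr
          exact le_self_pow₀ (by linarith) (by omega)
      _ = _ := by rw [two_mul, pow_add]
  calc N * Real.exp (-q) ≤ (m : ℝ) ^ (2 * d) * (δ / (12 * m)) ^ (2 * d) := by gcongr
    _ = (δ / 12) ^ (2 * d) := by
        rw [← mul_pow]; congr 1; field_simp
    _ ≤ δ / 12 := pow_le_of_le_one (by positivity) (by linarith) (by omega)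
    _ ≤ δ := by linarith

section

/-- The radius within which, with high probability, every point of `S` has a prototype. -/
noncomputable def coverRadius (d m : ℕ) (b c δ : ℝ) : ℝ :=
  (32 * d * Real.log (12 * m / δ) / (m * b * c * unitBallVol d)) ^ ((1 : ℝ) / d)

variable {d m : ℕ} {Q : Measure (Cov d)} {S : Set (Cov d)} {ρ₀ T₀ c b M δ : ℝ}

theorem coverRadius_pow (hd : 1 ≤ d) (hm : 3 ≤ m) (hb : 0 < b) (hc : 0 < c) (hδ : 0 < δ)
    (hδ1 : δ ≤ 1) : coverRadius d m b c δ ^ d =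
      32 * d * Real.log (12 * m / δ) / (m * b * c * unitBallVol d) := by
  have hlog := one_le_log_of_three_le (m := m) (by exact_mod_cast hm) hδ hδ1
  have hV := unitBallVol_pos d
  rw [coverRadius, one_div, Real.rpow_inv_natCast_pow (by positivity) (by omega)]

theorem coverRadius_pos (hd : 1 ≤ d) (hm : 3 ≤ m) (hb : 0 < b) (hc : 0 < c) (hδ : 0 < δ)
    (hδ1 : δ ≤ 1) : 0 < coverRadius d m b c δ := by
  have hlog := one_le_log_of_three_le (m := m) (by exact_mod_cast hm) hδ hδ1
  have hV := unitBallVol_pos d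
  have hd0 : (0 : ℝ) < d := by exact_mod_cast hd
  have hm0 : (0 : ℝ) < m := by exact_mod_cast (by omega : 0 < m)
  exact Real.rpow_pos_of_pos (by positivity) _

/-- With probability at least `1 - δ`, every point of `S` is within `coverRadius` of some
prototype. -/
theorem measure_not_covered_le [IsProbabilityMeasure Q] (hd : 1 ≤ d) (hm : 3 ≤ m) (hδ : 0 < δ)
    (hδ1 : δ ≤ 1) (h : IsRegularLaw Q S ρ₀ T₀ c b M) (hS : S.Nonempty)
    (hT : 32 * d * Real.log (12 * m / δ) ≤ T₀ ^ d * m * b * c * unitBallVol d) :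
    Measure.pi (fun _ : Fin m => Q)
      {z | ¬ ∀ y ∈ S, ∃ j, dist y (z j) ≤ coverRadius d m b c δ} ≤ ENNReal.ofReal δ := by
  set τ := coverRadius d m b c δ with hτdef
  have hτpos : 0 < τ := coverRadius_pos hd hm h.b_pos h.c_pos hδ hδ1
  have hτpow := coverRadius_pow hd hm h.b_pos h.c_pos hδ hδ1
  rw [← hτdef] at hτpow
  have hlog := one_le_log_of_three_le (m := m) (by exact_mod_cast hm) hδ hδ1
  set ℓ := Real.log (12 * m / δ)
  have hV := unitBallVol_pos d
  have hb := h.b_pos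
  have hc := h.c_pos
  have hd1 : (1 : ℝ) ≤ d := by exact_mod_cast hd
  have hm0 : (0 : ℝ) < m := by exact_mod_cast (by omega : 0 < m)
  -- The second condition on `m` says exactly that `τ` is a scale at which `S` is regular.
  have hτT : τ ≤ T₀ := by
    refine le_of_pow_le_pow_left₀ (n := d) (by omega) h.T_pos.le ?_
    rw [hτpow, div_le_iff₀ (by positivity)]
    linarith
  have hβ : b * c * unitBallVol d * τ ^ d = 32 * d * ℓ / m := by
    rw [hτpow]; field_simp
  have hmass : ∀ y ∈ S, ∀ s, 0 < s → s ≤ τ →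
      ENNReal.ofReal (b * c * unitBallVol d * s ^ d) ≤ Q (Metric.closedBall y s) :=
    fun y hy s hs hsτ => (h.le_measure_inter_closedBall hy hs (hsτ.trans hτT)).trans
      (measure_mono inter_subset_right)
  -- This quantity is a lower bound for the mass of a `τ`-ball, hence at most `1`. The inequality `4
  -- d ≤ m` thus comes from the hypotheses already present.
  have hβ1 : 32 * d * ℓ / m ≤ 1 := by
    obtain ⟨y, hy⟩ := hS
    have := (hmass y hy τ hτpos le_rfl).trans prob_le_one
    rwa [ENNReal.ofReal_le_one, hβ] at this
  have hmd : 4 * (d : ℝ) ≤ m := by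
    rw [div_le_one hm0] at hβ1
    nlinarith
  have hr : τ / (2 * d) / 2 = τ / (4 * d) := by field_simp; norm_num
  have hp1 : b * c * unitBallVol d * (τ / (4 * d)) ^ d = 32 * d * ℓ / m / (4 * d) ^ d := by
    rw [div_pow, ← mul_div_assoc, hβ]
  obtain ⟨T, hTS, hTc, hTcov⟩ := exists_finset_cover Q (S := S) (r := τ / (2 * d))
    (p := 32 * d * ℓ / m / (4 * d) ^ d) (by positivity) (fun y hy => by
      rw [hr, ← hp1]
      refine hmass y hy _ (by positivity) (div_le_self hτpos.le (by linarith)))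
  have hs : 0 < τ - τ / (2 * d) := by
    rw [sub_pos, div_lt_iff₀ (by positivity)]
    nlinarith
  -- Bernoulli's inequality. It explains the mesh `τ / (2d)`: shrinking the radius by that much
  -- costs at most half of the mass bound, whatever the dimension.
  have hhalf : (1 / 2 : ℝ) ≤ (1 - 1 / (2 * d)) ^ d := by
    have h1 := one_add_mul_le_pow (a := -(1 / (2 * d : ℝ)))
      (by have : 1 / (2 * d : ℝ) ≤ 1 := by { rw [div_le_one (by positivity)]; linarith }
          linarith) d
    have h2 : (d : ℝ) * -(1 / (2 * d)) = -(1 / 2) := by field_simp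
    rw [h2] at h1
    rw [sub_eq_add_neg]
    linarith
  have hp2 : 16 * d * ℓ ≤ m * (b * c * unitBallVol d * (τ - τ / (2 * d)) ^ d) := by
    have : τ - τ / (2 * d) = τ * (1 - 1 / (2 * d)) := by ring
    rw [this, mul_pow, ← mul_assoc (b * c * unitBallVol d), hβ]
    calc 16 * d * ℓ = m * (32 * d * ℓ / m * (1 / 2)) := by field_simp; norm_num
      _ ≤ _ := by gcongr
  calc _ ≤ Measure.pi (fun _ : Fin m => Q)
        {z | ∃ u ∈ T, ∀ j, τ - τ / (2 * d) < dist u (z j)} := by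
        refine measure_mono fun z hz => ?_
        simp only [mem_ofPred_eq, not_forall, not_exists, not_le] at hz
        obtain ⟨y, hy, hz⟩ := hz
        obtain ⟨u, hu, hyu⟩ := hTcov y hy
        refine ⟨u, hu, fun j => ?_⟩
        have := hz j
        have := dist_triangle y u (z j)
        linarith
    _ ≤ _ := measure_exists_notMem_closedBall_le Q T fun u hu =>
        hmass u (hTS hu) _ hs (sub_le_self _ (by positivity))
    _ ≤ _ := by
        refine ENNReal.ofReal_le_ofReal (card_mul_exp_le hd hm hδ hδ1 hmd ?_ hp2)
        rw [div_div, ← mul_div_assoc, div_le_one (by positivity)] at hTc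
        have h1 : (T.card : ℝ) * 1 ≤ T.card * (32 * d * ℓ) := by
          gcongr
          nlinarith
        linarith

/-- The lower bound `δ^d / (ψ_d m)` for the mass of the cell of a point. -/
noncomputable def cellMass (d m : ℕ) (M c b δ : ℝ) : ℝ := (δ * (c * b / M) / (18 * d)) ^ d / m

theorem cellMass_pos (hd : 1 ≤ d) (hm : 3 ≤ m) (hb : 0 < b) (hc : 0 < c) (hM : 0 < M)
    (hδ : 0 < δ) : 0 < cellMass d m M c b δ := by
  have hd0 : (0 : ℝ) < d := by exact_mod_cast hd
  have hm0 : (0 : ℝ) < m := by exact_mod_cast (by omega : 0 < m)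
  rw [cellMass]; positivity

/-- With probability at least `1 - δ`, the cell of `x` has mass at least `cellMass`. -/
theorem measure_localCell_lt_le [IsProbabilityMeasure Q] (hd : 1 ≤ d) (hm : 3 ≤ m) (hδ : 0 < δ)
    (hδ1 : δ ≤ 1) (h : IsRegularLaw Q S ρ₀ T₀ c b M) {x : Cov d} (hx : x ∈ S)
    (hT : 32 * d * Real.log (12 * m / δ) ≤ T₀ ^ d * m * b * c * unitBallVol d) :
    Measure.pi (fun _ : Fin m => Q)
      {z | ¬ ENNReal.ofReal (cellMass d m M c b δ) ≤ Q (localCell S z x)} ≤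
        ENNReal.ofReal δ := by
  have hlog := one_le_log_of_three_le (m := m) (by exact_mod_cast hm) hδ hδ1
  set ℓ := Real.log (12 * m / δ)
  have hV := unitBallVol_pos d
  have hb := h.b_pos
  have hc := h.c_pos
  have hM := h.M_pos
  have hd1 : (1 : ℝ) ≤ d := by exact_mod_cast hd
  have hm0 : (0 : ℝ) < m := by exact_mod_cast (by omega : 0 < m)
  have hp0 := cellMass_pos hd hm hb hc hM hδ
  set a := c * b / M with ha
  have ha0 : 0 < a := by positivity
  have ha1 : a ≤ 1 := by
    rw [ha, div_le_one hM]
    nlinarith [h.c_le_one ⟨x, hx⟩, h.b_le_M]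
  set p₀ := cellMass d m M c b δ with hp₀
  set B := b * c * unitBallVol d with hB
  have hB0 : 0 < B := by positivity
  -- The separation scale is chosen so that the guaranteed mass of an `s`-ball centred in `S` is
  -- exactly `p₀`.
  obtain ⟨s, hs, hsd⟩ : ∃ s : ℝ, 0 < s ∧ B * s ^ d = p₀ := by
    refine ⟨(p₀ / B) ^ ((1 : ℝ) / d), Real.rpow_pos_of_pos (by positivity) _, ?_⟩
    rw [one_div, Real.rpow_inv_natCast_pow (by positivity) (by omega)]
    field_simp
  have hbase : δ * a / (18 * d) ≤ 1 := by
    rw [div_le_one (by positivity)]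
    nlinarith
  have hsT : s ≤ T₀ := by
    refine le_of_pow_le_pow_left₀ (n := d) (by omega) h.T_pos.le ?_
    refine le_of_mul_le_mul_left ?_ hB0
    have h1 : p₀ ≤ 1 / m := by
      rw [hp₀, cellMass]
      gcongr
      exact pow_le_one₀ (by positivity) hbase
    have h2 : 1 / m ≤ B * T₀ ^ d := by
      rw [div_le_iff₀ hm0]
      calc (1 : ℝ) ≤ 32 * d * ℓ := by nlinarith
        _ ≤ _ := hT
        _ = _ := by rw [hB]; ring
    linarith
  -- One factor `a = c b / M` of the `d`-th power absorbs `1 / a`; the other factors are at most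
  -- `1`.
  have hq : m * (M * unitBallVol d * (2 * s) ^ d) ≤ δ := by
    calc m * (M * unitBallVol d * (2 * s) ^ d) = m * (1 / a) * 2 ^ d * (B * s ^ d) := by
          rw [mul_pow, ha, hB]; field_simp
      _ = (1 / a) * (δ * a / (9 * d)) ^ d := by
          have : δ * a / (9 * d) = 2 * (δ * a / (18 * d)) := by field_simp; norm_num
          rw [hsd, hp₀, cellMass, ← ha, this, mul_pow]
          field_simp
      _ ≤ (1 / a) * (δ * a / (9 * d)) := by
          gcongr
          refine pow_le_of_le_one (by positivity) ?_ (by omega)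
          rw [div_le_one (by positivity)]
          nlinarith
      _ = δ / (9 * d) := by field_simp
      _ ≤ δ := div_le_self hδ.le (by linarith)
  -- The lower bound on the mass of balls holds only for centres in `S`.
  have hae : ∀ᵐ z ∂(Measure.pi fun _ : Fin m => Q), ∀ j, z j ∈ S := by
    rw [ae_all_iff]
    intro j
    exact (Measure.quasiMeasurePreserving_eval (fun _ : Fin m => Q) j).ae
      (p := fun y => y ∈ S) h.measure_compl_eq_zero
  calc _ ≤ Measure.pi (fun _ : Fin m => Q) {z | ∃ k j : Fin m,
      nearestIndex z x = (k : WithBot (Fin m)) ∧ j ≠ k ∧ dist (z j) (z k) ≤ 2 * s} := by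
        refine measure_mono_ae (hae.mono fun z hzS hz => ?_)
        by_contra hsep
        refine hz ?_
        obtain ⟨k, hk⟩ := exists_nearestIndex_eq (by omega : 0 < m) z x
        rw [← hsd]
        refine (h.le_measure_inter_closedBall (hzS k) hs hsT).trans (measure_mono ?_)
        refine inter_closedBall_subset_localCell hk fun j hj => ?_
        by_contra hle
        exact hsep ⟨k, j, hk, hj, not_lt.1 hle⟩
    _ ≤ m * ENNReal.ofReal (M * unitBallVol d * (2 * s) ^ d) :=
        measure_exists_dist_nearest_le Q x fun w => h.measure_closedBall_le w (by positivity)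
    _ ≤ ENNReal.ofReal δ := by
        rw [← ENNReal.ofReal_natCast, ← ENNReal.ofReal_mul (by positivity)]
        exact ENNReal.ofReal_le_ofReal hq

end

/-! ### Tail bounds for an i.i.d. sample -/

theorem lintegral_pi_prod {E : Type*} [MeasurableSpace E] (P : Measure E) [IsProbabilityMeasure P]
    {n : ℕ} (F : Fin n → E → ℝ≥0∞) (hF : ∀ i, Measurable (F i)) :
    ∫⁻ w, ∏ i, F i (w i) ∂(Measure.pi fun _ : Fin n => P) = ∏ i, ∫⁻ e, F i e ∂P := by
  induction n with
  | zero => simp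
  | succ n ih =>
    have hmp := (measurePreserving_piFinSuccAbove (fun _ : Fin (n + 1) => P) 0).symm
    have hm' : Measurable fun w : Fin n → E => ∏ i : Fin n, F i.succ (w i) :=
      Finset.measurable_prod _ fun i _ => (hF _).comp (measurable_pi_apply i)
    have hm : Measurable fun w : Fin (n + 1) → E => ∏ i, F i (w i) :=
      Finset.measurable_prod _ fun i _ => (hF i).comp (measurable_pi_apply i)
    rw [← hmp.lintegral_comp hm, Fin.prod_univ_succ, ← ih _ fun i => hF i.succ,
      ← lintegral_prod_mul (hF 0).aemeasurable hm'.aemeasurable]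
    simp [MeasurableEquiv.piFinSuccAbove_symm_apply, Fin.insertNthEquiv, Fin.prod_univ_succ]

section

variable {E : Type*} {n : ℕ} {V : Set E}

/-- The number of sample points in `V`. -/
noncomputable def hits (V : Set E) (w : Fin n → E) : ℝ := ∑ i, V.indicator (fun _ => (1 : ℝ)) (w i)

/-- The sum of `h` over the sample points in `V`. -/
noncomputable def sumOver (V : Set E) (h : E → ℝ) (w : Fin n → E) : ℝ := ∑ i, V.indicator h (w i)

open Classical in
/-- The indices of the sample points in `V`. -/
noncomputable def hitSet (V : Set E) (w : Fin n → E) : Finset (Fin n) :=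
  Finset.univ.filter fun i => w i ∈ V

theorem hits_eq_card (w : Fin n → E) : hits V w = (hitSet V w).card := by
  classical
  simp [hits, hitSet, Set.indicator_apply, Finset.sum_boole]

theorem sumOver_eq_sum (h : E → ℝ) (w : Fin n → E) :
    sumOver V h w = ∑ i ∈ hitSet V w, h (w i) := by
  classical
  simp [sumOver, hitSet, Set.indicator_apply, Finset.sum_filter]

theorem hits_nonneg (w : Fin n → E) : 0 ≤ hits V w := by
  rw [hits_eq_card]; positivity

theorem setOf_hitSet_eq (I : Finset (Fin n)) :
    {w : Fin n → E | hitSet V w = I} = univ.pi fun i => if i ∈ I then V else Vᶜ := by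
  ext w
  simp only [mem_ofPred_eq, hitSet, Finset.ext_iff, Finset.mem_filter, Finset.mem_univ,
    true_and, mem_pi]
  refine forall_congr' fun i => ?_
  by_cases hi : i ∈ I <;> simp [hi]

variable [MeasurableSpace E] {P : Measure E} [IsProbabilityMeasure P]

/-- A multiplicative Chernoff bound for the number of sample points in `V`. -/
theorem measure_hits_lt_le (hV : MeasurableSet V) {p : ℝ} (hp : 0 ≤ p)
    (hpV : ENNReal.ofReal p ≤ P V) :
    Measure.pi (fun _ : Fin n => P) {w | hits V w < n * p / 2} ≤
      ENNReal.ofReal (Real.exp (-(n * p / 8))) := by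
  classical
  -- The exponential tilt with parameter `log 2`: `F` is `1/2` on `V` and `1` elsewhere, with
  -- integral `1 - P V / 2`. The exponent obtained is `(1 - log 2) n p / 2`, which exceeds `n p /
  -- 8`.
  let F : E → ℝ≥0∞ := fun e => V.indicator (fun _ => ENNReal.ofReal (1 / 2)) e +
    Vᶜ.indicator (fun _ => 1) e
  have hF : Measurable F :=
    (measurable_const.indicator hV).add (measurable_const.indicator hV.compl)
  have hFexp : ∀ e, F e =
      ENNReal.ofReal (Real.exp (-Real.log 2 * V.indicator (fun _ => (1 : ℝ)) e)) := fun e => by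
    by_cases he : e ∈ V
    · simp [F, he, Real.exp_neg, Real.exp_log]
    · simp [F, he]
  have hint : ∫⁻ e, F e ∂P ≤ ENNReal.ofReal (Real.exp (-(p / 2))) := by
    have hPV : P V ≠ ∞ := measure_ne_top _ _
    have hpV' : p ≤ (P V).toReal := by rwa [← ENNReal.ofReal_le_iff_le_toReal hPV]
    have hle : (P V).toReal ≤ 1 := measureReal_le_one
    calc ∫⁻ e, F e ∂P = ENNReal.ofReal (1 / 2) * P V + P Vᶜ := by
          rw [lintegral_add_left (measurable_const.indicator hV), lintegral_indicator_const hV,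
            lintegral_indicator_const hV.compl, one_mul]
      _ = ENNReal.ofReal (1 / 2 * (P V).toReal + (1 - (P V).toReal)) := by
          rw [prob_compl_eq_one_sub hV, ENNReal.ofReal_add (by positivity) (by linarith),
            ENNReal.ofReal_mul (by norm_num), ENNReal.ofReal_toReal hPV,
            ENNReal.ofReal_sub _ ENNReal.toReal_nonneg, ENNReal.ofReal_one,
            ENNReal.ofReal_toReal hPV]
      _ ≤ _ := ENNReal.ofReal_le_ofReal (by linarith [Real.add_one_le_exp (-(p / 2))])
  have hprod : ∀ w : Fin n → E, ∏ i, F (w i) =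
      ENNReal.ofReal (Real.exp (-Real.log 2 * hits V w)) := fun w => by
    simp_rw [hFexp]
    rw [← ENNReal.ofReal_prod_of_nonneg fun _ _ => (Real.exp_pos _).le, ← Real.exp_sum, hits,
      Finset.mul_sum]
  set s : ℝ := -Real.log 2 * (n * p / 2)
  calc Measure.pi (fun _ : Fin n => P) {w | hits V w < n * p / 2}
      ≤ Measure.pi (fun _ : Fin n => P) {w | ENNReal.ofReal (Real.exp s) ≤ ∏ i, F (w i)} := by
        refine measure_mono fun w hw => ?_
        simp only [mem_ofPred_eq] at hw ⊢
        rw [hprod]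
        refine ENNReal.ofReal_le_ofReal (Real.exp_le_exp.2 ?_)
        exact mul_le_mul_of_nonpos_left hw.le (neg_nonpos.2 (Real.log_pos one_lt_two).le)
    _ ≤ (∫⁻ w, ∏ i, F (w i) ∂(Measure.pi fun _ : Fin n => P)) / ENNReal.ofReal (Real.exp s) :=
        meas_ge_le_lintegral_div (Finset.measurable_prod _ fun i _ =>
          hF.comp (measurable_pi_apply i)).aemeasurable
          (ENNReal.ofReal_pos.2 (Real.exp_pos _)).ne' ENNReal.ofReal_ne_top
    _ ≤ (ENNReal.ofReal (Real.exp (-(p / 2)))) ^ n / ENNReal.ofReal (Real.exp s) := by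
        rw [lintegral_pi_prod P (fun _ => F) fun _ => hF, Finset.prod_const, Finset.card_univ,
          Fintype.card_fin]
        gcongr
    _ = ENNReal.ofReal (Real.exp (-(n * p / 2) - s)) := by
        rw [← ENNReal.ofReal_pow (Real.exp_pos _).le, ← ENNReal.ofReal_div_of_pos (Real.exp_pos _),
          ← Real.exp_nat_mul, ← Real.exp_sub]
        ring_nf
    _ ≤ _ := by
        refine ENNReal.ofReal_le_ofReal (Real.exp_le_exp.2 ?_)
        have := Real.log_two_lt_d9
        have hnp : 0 ≤ n * p := by positivity
        simp only [s]
        nlinarith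

theorem measurableSet_hitSet_eq (hV : MeasurableSet V) (I : Finset (Fin n)) :
    MeasurableSet {w : Fin n → E | hitSet V w = I} := by
  classical
  rw [setOf_hitSet_eq]
  exact MeasurableSet.univ_pi fun i => by split_ifs; exacts [hV, hV.compl]

/-- Chernoff's bound for a sub-Gaussian sum on the event that exactly the points with index in `I`
are in `V`. -/
theorem measure_hitSet_eq_and_lt_le (hV : MeasurableSet V) {h : E → ℝ} (hh : Measurable h)
    {σ : ℝ} (hsub : ∀ t : ℝ, ∫⁻ e in V, ENNReal.ofReal (Real.exp (t * h e)) ∂P ≤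
      ENNReal.ofReal (Real.exp (σ ^ 2 * t ^ 2 / 2)) * P V)
    (I : Finset (Fin n)) {t s : ℝ} (ht : 0 ≤ t) :
    Measure.pi (fun _ : Fin n => P) {w | hitSet V w = I ∧ s < ∑ i ∈ I, h (w i)} ≤
      ENNReal.ofReal (Real.exp (I.card * (σ ^ 2 * t ^ 2 / 2) - t * s)) *
        Measure.pi (fun _ : Fin n => P) {w | hitSet V w = I} := by
  classical
  let F : Fin n → E → ℝ≥0∞ := fun i => if i ∈ I then
    V.indicator fun e => ENNReal.ofReal (Real.exp (t * h e)) else Vᶜ.indicator fun _ => 1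
  have hF : ∀ i, Measurable (F i) := fun i => by
    simp only [F]
    split_ifs
    · exact (Real.measurable_exp.comp (hh.const_mul t)).ennreal_ofReal.indicator hV
    · exact measurable_const.indicator hV.compl
  have hbox : Measure.pi (fun _ : Fin n => P) {w | hitSet V w = I} =
      ∏ i, P (if i ∈ I then V else Vᶜ) := by
    rw [setOf_hitSet_eq, Measure.pi_pi]
  have hFint : ∀ i, ∫⁻ e, F i e ∂P ≤ (if i ∈ I then
      ENNReal.ofReal (Real.exp (σ ^ 2 * t ^ 2 / 2)) else 1) * P (if i ∈ I then V else Vᶜ) := by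
    intro i
    simp only [F]
    split_ifs
    · rw [lintegral_indicator hV]; exact hsub t
    · rw [lintegral_indicator_const hV.compl]
  calc _ ≤ Measure.pi (fun _ : Fin n => P)
        {w | ENNReal.ofReal (Real.exp (t * s)) ≤ ∏ i, F i (w i)} := by
        refine measure_mono fun w hw => ?_
        obtain ⟨rfl, hs⟩ := hw
        have : ∏ i, F i (w i) = ∏ i ∈ hitSet V w, ENNReal.ofReal (Real.exp (t * h (w i))) := by
          rw [hitSet, Finset.prod_filter]
          refine Finset.prod_congr rfl fun i _ => ?_
          by_cases hi : w i ∈ V <;> simp [F, hitSet, hi]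
        simp only [mem_ofPred_eq]
        rw [this, ← ENNReal.ofReal_prod_of_nonneg fun _ _ => (Real.exp_pos _).le, ← Real.exp_sum,
          ← Finset.mul_sum]
        refine ENNReal.ofReal_le_ofReal (Real.exp_le_exp.2 ?_)
        gcongr
    _ ≤ (∫⁻ w, ∏ i, F i (w i) ∂(Measure.pi fun _ : Fin n => P)) /
          ENNReal.ofReal (Real.exp (t * s)) :=
        meas_ge_le_lintegral_div (Finset.measurable_prod _ fun i _ =>
          (hF i).comp (measurable_pi_apply i)).aemeasurable
          (ENNReal.ofReal_pos.2 (Real.exp_pos _)).ne' ENNReal.ofReal_ne_top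
    _ ≤ (ENNReal.ofReal (Real.exp (σ ^ 2 * t ^ 2 / 2)) ^ I.card *
          ∏ i, P (if i ∈ I then V else Vᶜ)) / ENNReal.ofReal (Real.exp (t * s)) := by
        rw [lintegral_pi_prod P F hF]
        gcongr
        refine (Finset.prod_le_prod' fun i _ => hFint i).trans_eq ?_
        rw [Finset.prod_mul_distrib, Finset.prod_ite_mem, Finset.univ_inter, Finset.prod_const]
    _ = _ := by
        rw [hbox, ← ENNReal.ofReal_pow (Real.exp_pos _).le, ← Real.exp_nat_mul,
          ENNReal.mul_div_right_comm, ← ENNReal.ofReal_div_of_pos (Real.exp_pos _), ← Real.exp_sub]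

theorem measure_sqrt_lt_sumOver_le_of_pos (hV : MeasurableSet V) {h : E → ℝ} (hh : Measurable h)
    {σ : ℝ} (hσ : 0 < σ) (hsub : ∀ t : ℝ, ∫⁻ e in V, ENNReal.ofReal (Real.exp (t * h e)) ∂P ≤
      ENNReal.ofReal (Real.exp (σ ^ 2 * t ^ 2 / 2)) * P V) {ℓ : ℝ} (hℓ : 0 ≤ ℓ) :
    Measure.pi (fun _ : Fin n => P) {w | √(2 * σ ^ 2 * hits V w * ℓ) < sumOver V h w} ≤
      ENNReal.ofReal (Real.exp (-ℓ)) := by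
  classical
  set π := Measure.pi (fun _ : Fin n => P)
  have hI : ∀ I : Finset (Fin n),
      π {w | hitSet V w = I ∧ √(2 * σ ^ 2 * I.card * ℓ) < ∑ i ∈ I, h (w i)} ≤
        ENNReal.ofReal (Real.exp (-ℓ)) * π {w | hitSet V w = I} := by
    intro I
    rcases I.eq_empty_or_nonempty with rfl | hne
    · simp
    have hc : (0 : ℝ) < I.card := by exact_mod_cast hne.card_pos
    -- The optimal Chernoff parameter. It depends on the number of hits, which is allowed because
    -- that number is fixed on the event `hitSet V w = I`.
    set t := √(2 * ℓ / (σ ^ 2 * I.card)) with ht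
    have hts : t * √(2 * σ ^ 2 * I.card * ℓ) = 2 * ℓ := by
      have h4 : 2 * ℓ / (σ ^ 2 * I.card) * (2 * σ ^ 2 * I.card * ℓ) = (2 * ℓ) ^ 2 := by
        field_simp
      rw [ht, ← Real.sqrt_mul (by positivity), h4, Real.sqrt_sq (by positivity)]
    have ht2 : t ^ 2 = 2 * ℓ / (σ ^ 2 * I.card) := Real.sq_sqrt (by positivity)
    refine (measure_hitSet_eq_and_lt_le hV hh hsub I (t := t) (Real.sqrt_nonneg _)).trans_eq ?_
    rw [hts, ht2]
    congr 3
    field_simp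
    ring
  calc _ ≤ π (⋃ I : Finset (Fin n),
        {w | hitSet V w = I ∧ √(2 * σ ^ 2 * I.card * ℓ) < ∑ i ∈ I, h (w i)}) := by
        refine measure_mono fun w hw => mem_iUnion.2 ⟨hitSet V w, rfl, ?_⟩
        rw [← hits_eq_card, ← sumOver_eq_sum]
        exact hw
    _ ≤ ∑ I : Finset (Fin n), ENNReal.ofReal (Real.exp (-ℓ)) * π {w | hitSet V w = I} :=
        (measure_iUnion_fintype_le _ _).trans (Finset.sum_le_sum fun I _ => hI I)
    -- The events are disjoint, so the sum over all `I` loses no factor.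
    _ = ENNReal.ofReal (Real.exp (-ℓ)) * π (⋃ I : Finset (Fin n), {w | hitSet V w = I}) := by
        rw [← Finset.mul_sum, measure_iUnion _ fun I => measurableSet_hitSet_eq hV I,
          tsum_fintype]
        intro I J hIJ
        refine Set.disjoint_left.2 fun w hw hw' => hIJ ?_
        exact hw.symm.trans hw'
    _ ≤ _ := mul_le_of_le_one_right' prob_le_one

/-- A self-normalised sub-Gaussian tail bound for the noise over the sample points in `V`. -/
theorem measure_sqrt_lt_sumOver_le (hV : MeasurableSet V) {h : E → ℝ} (hh : Measurable h)
    {σ : ℝ} (hsub : ∀ t : ℝ, ∫⁻ e in V, ENNReal.ofReal (Real.exp (t * h e)) ∂P ≤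
      ENNReal.ofReal (Real.exp (σ ^ 2 * t ^ 2 / 2)) * P V) {ℓ : ℝ} (hℓ : 0 ≤ ℓ) :
    Measure.pi (fun _ : Fin n => P) {w | √(2 * σ ^ 2 * hits V w * ℓ) < sumOver V h w} ≤
      ENNReal.ofReal (Real.exp (-ℓ)) := by
  -- For `σ = 0` there is no optimal parameter `t`. The bound is applied with larger parameters
  -- decreasing to `σ²`; the strict inequality makes the event lie in the increasing union of the
  -- approximating events.
  let s : ℕ → ℝ := fun k => √(σ ^ 2 + 1 / (k + 1))
  have hs : ∀ k, s k ^ 2 = σ ^ 2 + 1 / (k + 1) := fun k => Real.sq_sqrt (by positivity)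
  let U : ℕ → Set (Fin n → E) := fun k => {w | √(2 * s k ^ 2 * hits V w * ℓ) < sumOver V h w}
  have hU : ∀ k, Measure.pi (fun _ : Fin n => P) (U k) ≤ ENNReal.ofReal (Real.exp (-ℓ)) :=
    fun k => measure_sqrt_lt_sumOver_le_of_pos hV hh (σ := s k) (Real.sqrt_pos.2 (by positivity))
      (fun t => (hsub t).trans (by
        have : σ ^ 2 ≤ s k ^ 2 := by
          rw [hs]
          linarith [show (0 : ℝ) ≤ 1 / (k + 1) by positivity]
        gcongr ENNReal.ofReal (Real.exp (?_ * t ^ 2 / 2)) * _)) hℓ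
  have hmono : Monotone U := by
    intro j k hjk w hw
    refine lt_of_le_of_lt (Real.sqrt_le_sqrt ?_) hw
    have := hits_nonneg (V := V) w
    rw [hs, hs]
    gcongr
  have hsub' : {w | √(2 * σ ^ 2 * hits V w * ℓ) < sumOver V h w} ⊆ ⋃ k, U k := by
    intro w hw
    have hlim : Filter.Tendsto (fun k : ℕ => √(2 * s k ^ 2 * hits V w * ℓ)) Filter.atTop
        (nhds √(2 * (σ ^ 2 + 0) * hits V w * ℓ)) := by
      simp_rw [hs]
      exact ((((tendsto_one_div_add_atTop_nhds_zero_nat.const_add _).const_mul _).mul_const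
        _).mul_const _).sqrt
    rw [add_zero] at hlim
    obtain ⟨k, hk⟩ := (hlim.eventually (gt_mem_nhds hw)).exists
    exact mem_iUnion.2 ⟨k, hk⟩
  calc _ ≤ _ := measure_mono hsub'
    _ = ⨆ k, Measure.pi (fun _ : Fin n => P) (U k) := hmono.measure_iUnion
    _ ≤ _ := iSup_le hU

end

/-! ### The good event -/

section

variable {Ω : Type*} [MeasurableSpace Ω] {μ : Measure Ω} [IsProbabilityMeasure μ]
  {d n m : ℕ} {P : Measure (Cov d × ℝ)} {S : Set (Cov d)}
  {g : Cov d → ℝ} {X : Fin n → Ω → Cov d} {Y : Fin n → Ω → ℝ} {Z : Fin m → Ω → Cov d}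
  {L : ℝ≥0} {σ ρ₀ T₀ c b M δ : ℝ}

/-- The noise `y - g x`, with `g` set to `0` outside of `S`. -/
noncomputable def noise (S : Set (Cov d)) (g : Cov d → ℝ) (e : Cov d × ℝ) : ℝ :=
  e.2 - S.indicator g e.1

theorem measurable_noise (hS : MeasurableSet S) (hg : LipschitzOnWith L g S) :
    Measurable (noise S g) := by
  classical
  have hSg : Measurable (S.indicator g) := by
    rw [← piecewise_eq_indicator]
    exact ContinuousOn.measurable_piecewise hg.continuousOn continuousOn_const hS
  exact measurable_snd.sub (hSg.comp measurable_fst)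

theorem measurable_sumOver_localCell (hS : MeasurableSet S) (x : Cov d) {h : Cov d × ℝ → ℝ}
    (hh : Measurable h) : Measurable fun q : (Fin m → Cov d) × (Fin n → Cov d × ℝ) =>
      sumOver (Prod.fst ⁻¹' localCell S q.1 x) h q.2 := by
  have hA : MeasurableSet {q : (Fin m → Cov d) × (Cov d × ℝ) | q.2.1 ∈ localCell S q.1 x} :=
    (measurable_fst.prodMk (measurable_fst.comp measurable_snd))
      (measurableSet_mem_localCell hS x)
  have hI : Measurable ({q : (Fin m → Cov d) × (Cov d × ℝ) |
      q.2.1 ∈ localCell S q.1 x}.indicator fun q => h q.2) := (hh.comp measurable_snd).indicator hA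
  have hev : ∀ i, Measurable fun q : (Fin m → Cov d) × (Fin n → Cov d × ℝ) => (q.1, q.2 i) :=
    fun i => by fun_prop
  have heq : (fun q : (Fin m → Cov d) × (Fin n → Cov d × ℝ) =>
      sumOver (Prod.fst ⁻¹' localCell S q.1 x) h q.2) = fun q => ∑ i,
        {q : (Fin m → Cov d) × (Cov d × ℝ) | q.2.1 ∈ localCell S q.1 x}.indicator
          (fun q => h q.2) (q.1, q.2 i) := by
    classical
    ext q
    simp [sumOver, indicator_apply]
  rw [heq]
  exact Finset.measurable_sum _ fun i _ => hI.comp (hev i)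

/-- The event `X i ∈ V` belongs to the conditioning `σ`-algebra, so the conditional bound can be
integrated over it. A deterministic `V` is enough, since the prototypes will be frozen. -/
theorem Setting.setLIntegral_exp_noise_le (hset : Setting μ P S g X Y Z L σ ρ₀ T₀ c b M)
    (i : Fin n) {V : Set (Cov d)} (hV : MeasurableSet V) (hVS : V ⊆ S) (t : ℝ) :
    ∫⁻ e in Prod.fst ⁻¹' V, ENNReal.ofReal (Real.exp (t * noise S g e)) ∂P ≤
      ENNReal.ofReal (Real.exp (σ ^ 2 * t ^ 2 / 2)) * P (Prod.fst ⁻¹' V) := by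
  have hXY : Measurable fun ω => (X i ω, Y i ω) :=
    (hset.measurable_X i).prodMk (hset.measurable_Y i)
  have hXZ : Measurable fun ω => (X i ω, fun j => Z j ω) :=
    (hset.measurable_X i).prodMk (measurable_pi_lambda _ hset.measurable_Z)
  have hVm : MeasurableSet (Prod.fst ⁻¹' V : Set (Cov d × ℝ)) := measurable_fst hV
  have hns := measurable_noise hset.regularLaw.measurableSet hset.lipschitz
  have hs : MeasurableSet (X i ⁻¹' V) := hset.measurable_X i hV
  have hs' : MeasurableSet[MeasurableSpace.comap (fun ω => (X i ω, fun j => Z j ω)) inferInstance]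
      (X i ⁻¹' V) := ⟨Prod.fst ⁻¹' V, measurable_fst hV, rfl⟩
  have hsg := hset.subGaussian i
  have hint := hsg.integrable_exp t
  have h1 : ∫⁻ e in Prod.fst ⁻¹' V, ENNReal.ofReal (Real.exp (t * noise S g e)) ∂P =
      ∫⁻ ω in X i ⁻¹' V, ENNReal.ofReal (Real.exp (t * (Y i ω - g (X i ω)))) ∂μ := by
    have hF : Measurable fun e => ENNReal.ofReal (Real.exp (t * noise S g e)) :=
      (Real.measurable_exp.comp (hns.const_mul t)).ennreal_ofReal
    rw [← hset.law_XY i, setLIntegral_map hVm hF hXY]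
    refine setLIntegral_congr_fun hs fun ω hω => ?_
    simp [noise, indicator_of_mem (hVS hω)]
  rw [h1, ← ofReal_integral_eq_lintegral_ofReal hint.integrableOn
    (ae_of_all _ fun _ => (Real.exp_pos _).le), ← setIntegral_condExp hXZ.comap_le hint hs',
    ← hset.law_XY i, Measure.map_apply hXY hVm]
  calc _ ≤ ENNReal.ofReal (∫ _ in X i ⁻¹' V, Real.exp (σ ^ 2 * t ^ 2 / 2) ∂μ) :=
        ENNReal.ofReal_le_ofReal (setIntegral_mono_ae integrable_condExp.integrableOn
          (integrable_const _) (hsg.condExp_exp_le t))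
    _ = _ := by
        rw [setIntegral_const, smul_eq_mul, mul_comm, ENNReal.ofReal_mul (Real.exp_pos _).le,
          ofReal_measureReal]
        rfl

theorem Setting.map_eq (hset : Setting μ P S g X Y Z L σ ρ₀ T₀ c b M) :
    μ.map (fun ω => ((fun j => Z j ω), fun i => (X i ω, Y i ω))) =
      (Measure.pi fun _ : Fin m => P.map Prod.fst).prod (Measure.pi fun _ : Fin n => P) := by
  have hXY : ∀ i, Measurable fun ω => (X i ω, Y i ω) := fun i =>
    (hset.measurable_X i).prodMk (hset.measurable_Y i)
  have hZ := hset.measurable_Z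
  rw [hset.indep_XY_Z.symm.map_prod_eq_prod_map_map (measurable_pi_lambda _ hZ).aemeasurable
      (measurable_pi_lambda _ hXY).aemeasurable,
    (iIndepFun_iff_map_fun_eq_pi_map fun j => (hZ j).aemeasurable).1 hset.indep_Z,
    (iIndepFun_iff_map_fun_eq_pi_map fun i => (hXY i).aemeasurable).1 hset.indep_XY]
  simp_rw [hset.law_Z, hset.law_XY]

/-- The bound on the slices of `U` is needed only for good prototypes `a ∉ D`: the part of `U` above
`D` is already counted in `D`. -/
theorem measure_prod_le_add {α β : Type*} [MeasurableSpace α] [MeasurableSpace β]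
    (ν : Measure α) [IsProbabilityMeasure ν] (π : Measure β) [IsProbabilityMeasure π]
    {D : Set α} {U : Set (α × β)} (hD : MeasurableSet D) (hU : MeasurableSet U) {p q : ℝ≥0∞}
    (hp : ν D ≤ p) (hq : ∀ a ∉ D, π (Prod.mk a ⁻¹' U) ≤ q) :
    ν.prod π (Prod.fst ⁻¹' D ∪ U) ≤ p + q := by
  have hsub : Prod.fst ⁻¹' D ∪ U ⊆ Prod.fst ⁻¹' D ∪ (U ∩ Prod.fst ⁻¹' Dᶜ) := by
    intro y hy
    by_cases h : y.1 ∈ D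
    · exact Or.inl h
    · exact hy.imp id fun hU => ⟨hU, h⟩
  refine (measure_mono hsub).trans ((measure_union_le _ _).trans (add_le_add ?_ ?_))
  · rw [← prod_univ, Measure.prod_prod]
    simpa using hp
  · rw [Measure.prod_apply (hU.inter (measurable_fst hD.compl))]
    calc _ ≤ ∫⁻ _, q ∂ν := by
          refine lintegral_mono fun a => ?_
          by_cases ha : a ∈ D
          · have : Prod.mk a ⁻¹' (U ∩ Prod.fst ⁻¹' Dᶜ) = ∅ := by
              ext y; simp [ha]
            rw [this, measure_empty]
            exact zero_le
          · exact (measure_mono fun y hy => hy.1).trans (hq a ha)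
      _ = q := by simp

theorem Setting.exists_good_event [IsProbabilityMeasure P]
    (hset : Setting μ P S g X Y Z L σ ρ₀ T₀ c b M) (hd : 1 ≤ d)
    (hδ : 0 < δ) (hδ1 : δ ≤ 1) (hn : 1 ≤ n) (hm : 3 ≤ m)
    (hnp : 8 * Real.log (1 / δ) ≤ n * cellMass d m M c b δ)
    (hT : 32 * d * Real.log (12 * m / δ) ≤ T₀ ^ d * m * b * c * unitBallVol d)
    {x : Cov d} (hx : x ∈ S) :
    ∃ A : Set Ω, MeasurableSet A ∧ ENNReal.ofReal (1 - 5 * δ) ≤ μ A ∧ ∀ ω ∈ A,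
      (∀ y ∈ S, ∃ j, dist y (Z j ω) ≤ coverRadius d m b c δ) ∧
      n * cellMass d m M c b δ / 2 ≤
        hits (Prod.fst ⁻¹' localCell S (fun j => Z j ω) x) (fun i => (X i ω, Y i ω)) ∧
      |sumOver (Prod.fst ⁻¹' localCell S (fun j => Z j ω) x) (noise S g)
          (fun i => (X i ω, Y i ω))| ≤
        √(2 * σ ^ 2 * hits (Prod.fst ⁻¹' localCell S (fun j => Z j ω) x)
          (fun i => (X i ω, Y i ω)) * Real.log (1 / δ)) := by
  have hreg := hset.regularLaw
  have hSm := hreg.measurableSet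
  set Q := P.map Prod.fst with hQ
  have : IsProbabilityMeasure Q := Measure.isProbabilityMeasure_map measurable_fst.aemeasurable
  set ν := Measure.pi fun _ : Fin m => Q with hν
  set π := Measure.pi fun _ : Fin n => P with hπ
  set p₀ := cellMass d m M c b δ with hp₀
  have hp0 : 0 < p₀ := cellMass_pos hd hm hreg.b_pos hreg.c_pos hreg.M_pos hδ
  set ℓ := Real.log (1 / δ) with hℓ
  have hℓ0 : 0 ≤ ℓ := Real.log_nonneg (by rw [le_div_iff₀ hδ]; linarith)
  have hexp : Real.exp (-ℓ) = δ := by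
    rw [hℓ, one_div, Real.log_inv, neg_neg, Real.exp_log hδ]
  have hns := measurable_noise hSm hset.lipschitz
  -- The covering event quantifies over all points of `S`; a measurable hull avoids proving that it
  -- is measurable.
  set D := toMeasurable ν ({z | ¬ ∀ y ∈ S, ∃ j, dist y (z j) ≤ coverRadius d m b c δ} ∪
    {z | ¬ ENNReal.ofReal p₀ ≤ Q (localCell S z x)}) with hD
  have hDν : ν D ≤ ENNReal.ofReal δ + ENNReal.ofReal δ := by
    rw [hD, measure_toMeasurable]
    exact (measure_union_le _ _).trans (add_le_add
      (measure_not_covered_le hd hm hδ hδ1 hreg ⟨x, hx⟩ hT)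
      (measure_localCell_lt_le hd hm hδ hδ1 hreg hx hT))
  have hDsub : ∀ z, z ∉ D → (∀ y ∈ S, ∃ j, dist y (z j) ≤ coverRadius d m b c δ) ∧
      ENNReal.ofReal p₀ ≤ Q (localCell S z x) := by
    intro z hz
    have hz' := fun h => hz (subset_toMeasurable ν _ h)
    simp only [mem_union, mem_ofPred_eq, ← not_and_or] at hz'
    exact not_not.1 hz'
  let V : (Fin m → Cov d) → Set (Cov d × ℝ) := fun z => Prod.fst ⁻¹' localCell S z x
  have hVc : ∀ z : Fin m → Cov d, MeasurableSet (localCell S z x) := fun z =>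
    measurable_prodMk_left (x := z) (measurableSet_mem_localCell hSm x)
  have hV : ∀ z, MeasurableSet (V z) := fun z => measurable_fst (hVc z)
  have hhits : Measurable fun q : (Fin m → Cov d) × (Fin n → Cov d × ℝ) => hits (V q.1) q.2 :=
    measurable_sumOver_localCell hSm x measurable_const
  let H : Set ((Fin m → Cov d) × (Fin n → Cov d × ℝ)) := {q | hits (V q.1) q.2 < n * p₀ / 2}
  let N : (Cov d × ℝ → ℝ) → Set ((Fin m → Cov d) × (Fin n → Cov d × ℝ)) := fun h =>
    {q | √(2 * σ ^ 2 * hits (V q.1) q.2 * ℓ) < sumOver (V q.1) h q.2}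
  have hH : MeasurableSet H := measurableSet_lt hhits measurable_const
  have hN : ∀ h, Measurable h → MeasurableSet (N h) := fun h hh =>
    measurableSet_lt ((hhits.const_mul _).mul_const _).sqrt (measurable_sumOver_localCell hSm x hh)
  have hHπ : ∀ z ∉ D, π (Prod.mk z ⁻¹' H) ≤ ENNReal.ofReal δ := by
    intro z hz
    have h1 := (hDsub z hz).2
    rw [hQ, Measure.map_apply measurable_fst (hVc z)] at h1
    refine (measure_hits_lt_le (hV z) hp0.le h1).trans (ENNReal.ofReal_le_ofReal ?_)
    rw [← hexp]
    exact Real.exp_le_exp.2 (by linarith)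
  have hsub := fun (z : Fin m → Cov d) (t : ℝ) =>
    hset.setLIntegral_exp_noise_le ⟨0, hn⟩ (hVc z) localCell_subset t
  have hN1 : ∀ z, π (Prod.mk z ⁻¹' N (noise S g)) ≤ ENNReal.ofReal δ := fun z => by
    have := measure_sqrt_lt_sumOver_le (n := n) (hV z) hns (hsub z) hℓ0
    rwa [hexp] at this
  have hN2 : ∀ z, π (Prod.mk z ⁻¹' N (fun e => -noise S g e)) ≤ ENNReal.ofReal δ := fun z => by
    have := measure_sqrt_lt_sumOver_le (n := n) (hV z) hns.neg (σ := σ) (fun t => by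
      simpa using hsub z (-t)) hℓ0
    rwa [hexp] at this
  set U := H ∪ (N (noise S g) ∪ N (fun e => -noise S g e)) with hU
  have hUm : MeasurableSet U := hH.union ((hN _ hns).union (hN _ hns.neg))
  have hDm : MeasurableSet D := measurableSet_toMeasurable _ _
  have hbad := measure_prod_le_add ν π hDm hUm hDν
    (q := ENNReal.ofReal δ + (ENNReal.ofReal δ + ENNReal.ofReal δ)) fun z hz => by
      rw [hU, preimage_union, preimage_union]
      exact (measure_union_le _ _).trans (add_le_add (hHπ z hz)
        ((measure_union_le _ _).trans (add_le_add (hN1 z) (hN2 z))))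
  have hW : MeasurableSet (Prod.fst ⁻¹' D ∪ U) := (measurable_fst hDm).union hUm
  have hXY : ∀ i, Measurable fun ω => (X i ω, Y i ω) := fun i =>
    (hset.measurable_X i).prodMk (hset.measurable_Y i)
  have hΦ : Measurable fun ω => ((fun j => Z j ω), fun i => (X i ω, Y i ω)) :=
    (measurable_pi_lambda _ hset.measurable_Z).prodMk (measurable_pi_lambda _ hXY)
  refine ⟨(fun ω => ((fun j => Z j ω), fun i => (X i ω, Y i ω))) ⁻¹' (Prod.fst ⁻¹' D ∪ U)ᶜ,
    hΦ hW.compl, ?_, ?_⟩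
  · rw [← Measure.map_apply hΦ hW.compl, hset.map_eq, prob_compl_eq_one_sub hW,
      ENNReal.ofReal_sub _ (by positivity), ENNReal.ofReal_one]
    refine tsub_le_tsub_left (hbad.trans_eq ?_) _
    -- Covering and cell mass, then the number of hits, then the two signs of the noise.
    have h5 : 5 * δ = δ + δ + (δ + (δ + δ)) := by ring
    rw [h5]
    repeat rw [ENNReal.ofReal_add (by positivity) (by positivity)]
  · intro ω hω
    simp only [mem_preimage, mem_compl_iff, mem_union, not_or, hU, H, N, mem_ofPred_eq,
      not_lt] at hω
    obtain ⟨h1, h2, h3, h4⟩ := hω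
    refine ⟨(hDsub _ h1).1, h2, abs_le.2 ⟨?_, h3⟩⟩
    have : sumOver (V fun j => Z j ω) (fun e => -noise S g e) (fun i => (X i ω, Y i ω)) =
        -sumOver (V fun j => Z j ω) (noise S g) (fun i => (X i ω, Y i ω)) := by
      rw [sumOver_eq_sum, sumOver_eq_sum, Finset.sum_neg_distrib]
    rw [this] at h4
    exact neg_le.2 h4

end

/-! ### The non-asymptotic bound -/

/-- The deterministic decomposition into noise and bias. Each sample point in the cell contributes
at most `localLip` times `2τ` to the bias, because `x` itself lies in the cell. -/
theorem abs_protoNN_sub_le {d m n : ℕ} {S : Set (Cov d)} {z : Fin m → Cov d} {x : Cov d}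
    {xs : Fin n → Cov d} {ys : Fin n → ℝ} {g : Cov d → ℝ} {L : ℝ≥0} {τ v : ℝ} (hm : 0 < m)
    (hg : LipschitzOnWith L g S) (hx : x ∈ S) (hcov : ∀ y ∈ S, ∃ j, dist y (z j) ≤ τ)
    (hpos : 0 < hits (Prod.fst ⁻¹' localCell S z x) (fun i => (xs i, ys i)))
    (hv : |sumOver (Prod.fst ⁻¹' localCell S z x) (noise S g) (fun i => (xs i, ys i))| ≤ v) :
    |protoNN S z xs ys x - g x| ≤
      v / hits (Prod.fst ⁻¹' localCell S z x) (fun i => (xs i, ys i)) +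
        2 * localLip g (localCell S z x) * τ := by
  classical
  set V := localCell S z x
  set w : Fin n → Cov d × ℝ := fun i => (xs i, ys i)
  set I := hitSet (Prod.fst ⁻¹' V) w with hI
  have hmem : ∀ i ∈ I, xs i ∈ V := fun i hi => (Finset.mem_filter.1 hi).2
  have hproto : protoNN S z xs ys x = (∑ i ∈ I, ys i) / hits (Prod.fst ⁻¹' V) w := by
    rw [protoNN]
    congr 1
    exact sumOver_eq_sum (V := Prod.fst ⁻¹' V) Prod.snd w
  have hdecomp : ∑ i ∈ I, ys i - g x * hits (Prod.fst ⁻¹' V) w =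
      sumOver (Prod.fst ⁻¹' V) (noise S g) w + ∑ i ∈ I, (g (xs i) - g x) := by
    rw [sumOver_eq_sum, ← hI, ← Finset.sum_add_distrib, hits_eq_card, ← hI, mul_comm,
      ← nsmul_eq_mul, ← Finset.sum_const, ← Finset.sum_sub_distrib]
    refine Finset.sum_congr rfl fun i hi => ?_
    simp only [noise, w, indicator_of_mem (localCell_subset (hmem i hi))]
    ring
  have hbias : |∑ i ∈ I, (g (xs i) - g x)| ≤
      2 * localLip g V * τ * hits (Prod.fst ⁻¹' V) w := by
    rw [hits_eq_card, ← hI, mul_comm _ (I.card : ℝ), ← nsmul_eq_mul, ← Finset.sum_const]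
    refine (Finset.abs_sum_le_sum_abs _ _).trans (Finset.sum_le_sum fun i hi => ?_)
    have h1 := abs_sub_le_localLip_mul hg localCell_subset (hmem i hi)
      (self_mem_localCell hm hx)
    have h2 := dist_le_of_mem_localCell hx hcov (hmem i hi)
    rw [dist_eq_norm] at h2
    nlinarith [localLip_nonneg g V]
  rw [hproto, div_sub' hpos.ne', mul_comm (hits _ _), hdecomp, abs_div, abs_of_pos hpos,
    div_le_iff₀ hpos, add_mul, div_mul_cancel₀ _ hpos.ne']
  exact (abs_add_le _ _).trans (add_le_add hv hbias)

theorem cellMass_eq {d m : ℕ} (hd : 1 ≤ d) {M c b δ : ℝ} (hM : 0 < M) (hc : 0 < c) (hb : 0 < b) :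
    cellMass d m M c b δ = δ ^ d / (psi d M c b * m) := by
  have hd0 : (0 : ℝ) < d := by exact_mod_cast hd
  rw [cellMass, psi, div_pow, mul_pow, mul_pow, mul_pow, mul_pow, div_pow, mul_pow]
  field_simp

theorem nonasymptotic_bound {d : ℕ} (hd : 1 ≤ d) {Ω : Type*} [MeasurableSpace Ω] {μ : Measure Ω}
    [IsProbabilityMeasure μ] {n m : ℕ} {P : Measure (Cov d × ℝ)} [IsProbabilityMeasure P]
    {S : Set (Cov d)} {g : Cov d → ℝ} {X : Fin n → Ω → Cov d} {Y : Fin n → Ω → ℝ}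
    {Z : Fin m → Ω → Cov d} {L : ℝ≥0} {σ ρ₀ T₀ c b M δ : ℝ}
    (hset : Setting μ P S g X Y Z L σ ρ₀ T₀ c b M) (hδ : 0 < δ) (hδ5 : δ < 1 / 5) (hn : 1 ≤ n)
    (hm : 3 ≤ m) (hnm : 8 * psi d M c b * Real.log (1 / δ) / δ ^ d ≤ (n : ℝ) / m)
    (hT : 32 * d * Real.log (12 * m / δ) ≤ T₀ ^ d * m * b * c * unitBallVol d)
    {x : Cov d} (hx : x ∈ S) :
    ∃ A : Set Ω, MeasurableSet A ∧ ENNReal.ofReal (1 - 5 * δ) ≤ μ A ∧ ∀ ω ∈ A,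
      |protoNN S (fun j => Z j ω) (fun i => X i ω) (fun i => Y i ω) x - g x| ≤
        √(4 * σ ^ 2 * psi d M c b * Real.log (1 / δ) / δ ^ d) * √((m : ℝ) / n)
        + 2 * localLip g (localCell S (fun j => Z j ω) x)
          * (32 * d * Real.log (12 * m / δ) / (m * b * c * unitBallVol d)) ^ ((1 : ℝ) / d) := by
  have hreg := hset.regularLaw
  have hM := hreg.M_pos
  have hc := hreg.c_pos
  have hb := hreg.b_pos
  have hm0 : (0 : ℝ) < m := by exact_mod_cast (by omega : 0 < m)
  have hn0 : (0 : ℝ) < n := by exact_mod_cast hn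
  have hd0 : (0 : ℝ) < d := by exact_mod_cast hd
  have hψ : 0 < psi d M c b := by rw [psi]; positivity
  have hp0 := cellMass_pos hd hm hb hc hM hδ
  have hpeq := cellMass_eq (m := m) (δ := δ) hd hM hc hb
  have hℓ : 0 ≤ Real.log (1 / δ) := Real.log_nonneg (by rw [le_div_iff₀ hδ]; linarith)
  set ℓ := Real.log (1 / δ)
  have hnp : 8 * ℓ ≤ n * cellMass d m M c b δ := by
    rw [div_le_div_iff₀ (by positivity) hm0] at hnm
    rw [hpeq, ← mul_div_assoc, le_div_iff₀ (by positivity)]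
    linarith
  obtain ⟨A, hA, hμA, hgood⟩ := hset.exists_good_event hd hδ (by linarith) hn hm hnp hT hx
  refine ⟨A, hA, hμA, fun ω hω => ?_⟩
  obtain ⟨hcov, hhits, hsum⟩ := hgood ω hω
  have hpos := lt_of_lt_of_le (by positivity) hhits
  refine (abs_protoNN_sub_le (by omega) hset.lipschitz hx hcov hpos hsum).trans
    (add_le_add ?_ le_rfl)
  set N := hits (Prod.fst ⁻¹' localCell S (fun j => Z j ω) x) fun i => (X i ω, Y i ω)
  rw [← Real.sqrt_mul (by positivity), div_le_iff₀ hpos]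
  refine Real.sqrt_le_iff.2 ⟨by positivity, ?_⟩
  rw [mul_pow, Real.sq_sqrt (by positivity)]
  -- The lower bound `n p₀ / 2` on the number of hits turns the constant `2` of the noise bound into
  -- `4`.
  have hval : 4 * σ ^ 2 * psi d M c b * ℓ / δ ^ d * (m / n) * (n * cellMass d m M c b δ / 2) =
      2 * σ ^ 2 * ℓ := by
    rw [hpeq]; field_simp; ring
  calc 2 * σ ^ 2 * N * ℓ = 2 * σ ^ 2 * ℓ * N := by ring
    _ ≤ 4 * σ ^ 2 * psi d M c b * ℓ / δ ^ d * (m / n) * N * N := by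
        rw [← hval]
        gcongr
    _ = _ := by ring

/-! ### The rate -/

theorem tendsto_log_div_atTop {δ : ℝ} (hδ : 0 < δ) :
    Filter.Tendsto (fun n : ℕ => Real.log (12 * n / δ) / n) Filter.atTop (nhds 0) := by
  have hy : Filter.Tendsto (fun n : ℕ => 12 * (n : ℝ) / δ) Filter.atTop Filter.atTop :=
    (tendsto_natCast_atTop_atTop.const_mul_atTop (by norm_num : (0 : ℝ) < 12)).atTop_div_const hδ
  have h1 := (Real.isLittleO_log_id_atTop.tendsto_div_nhds_zero.comp hy).const_mul (12 / δ)
  rw [mul_zero] at h1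
  refine h1.congr' ?_
  filter_upwards [Filter.eventually_gt_atTop 0] with n hn
  have : (0 : ℝ) < n := by exact_mod_cast hn
  simp only [Function.comp, id]
  field_simp

/-- The order of magnitude of the number of prototypes, in terms of the rate `u = C ℓ / n`. -/
theorem prototype_order_eq {d : ℕ} {x C ℓ : ℝ} (hx : 0 < x) (hC : 0 < C) (hℓ : 0 ≤ ℓ) :
    (x / C) ^ ((d : ℝ) / (d + 2)) * ℓ ^ ((2 : ℝ) / (d + 2)) =
      x / C * (C * ℓ / x) ^ ((2 : ℝ) / (d + 2)) := by
  have hsplit : ((d : ℝ) / (d + 2)) = 1 - 2 / (d + 2) := by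
    have : (d : ℝ) + 2 ≠ 0 := by positivity
    field_simp; ring
  have hu : C * ℓ / x = ℓ / (x / C) := by field_simp
  rw [hsplit, Real.rpow_sub (by positivity), Real.rpow_one, hu, Real.div_rpow hℓ (by positivity)]
  ring

theorem sqrt_term_le {d : ℕ} {m n C a r s : ℝ} (hC : 0 < C) (ha : 0 < a) (hn : 0 < n)
    (hr : 0 ≤ r) (hs : 0 ≤ s)
    (h : m ≤ a * (n / C * r ^ ((2 : ℝ) / (d + 2)))) :
    √(s * C) * √(m / n) ≤ √s * √a * r ^ ((1 : ℝ) / (d + 2)) := by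
  have hpow : r ^ ((2 : ℝ) / (d + 2)) = (r ^ ((1 : ℝ) / (d + 2))) ^ 2 := by
    rw [← Real.rpow_natCast, ← Real.rpow_mul hr]
    congr 1; push_cast; ring
  rw [Real.sqrt_mul hs, mul_assoc, mul_assoc, ← Real.sqrt_mul hC.le]
  refine mul_le_mul_of_nonneg_left ?_ (Real.sqrt_nonneg _)
  rw [← Real.sqrt_sq (Real.rpow_nonneg hr _), ← hpow, ← Real.sqrt_mul ha.le]
  refine Real.sqrt_le_sqrt ?_
  calc C * (m / n) = C / n * m := by ring
    _ ≤ C / n * (a * (n / C * r ^ ((2 : ℝ) / (d + 2)))) := by gcongr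
    _ = _ := by field_simp

theorem cover_term_le {d : ℕ} (hd : 1 ≤ d) {m n C a ℓ ℓ' D : ℝ} (hC : 0 < C) (ha : 0 < a)
    (hn : 0 < n) (hℓ : 0 < ℓ) (hm : 0 < m) (hD : 0 < D) (hℓ' : 0 ≤ ℓ') (hle : ℓ' ≤ ℓ)
    (h : a * (n / C * (C * ℓ / n) ^ ((2 : ℝ) / (d + 2))) ≤ m) :
    (32 * d * ℓ' / (m * D)) ^ ((1 : ℝ) / d) ≤
      (32 * d / D) ^ ((1 : ℝ) / d) * a⁻¹ ^ ((1 : ℝ) / d) * (C * ℓ / n) ^ ((1 : ℝ) / (d + 2)) := by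
  have hd0 : (0 : ℝ) < d := by exact_mod_cast hd
  set u := C * ℓ / n with hu
  have hu0 : 0 < u := by positivity
  have hpow : u ^ ((1 : ℝ) / (d + 2)) = (u ^ ((d : ℝ) / (d + 2))) ^ ((1 : ℝ) / d) := by
    rw [← Real.rpow_mul hu0.le]
    congr 1; field_simp
  have hsplit : u ^ ((d : ℝ) / (d + 2)) = u / u ^ ((2 : ℝ) / (d + 2)) := by
    rw [← Real.rpow_one_sub' hu0.le]
    · congr 1; field_simp; ring
    · have : (2 : ℝ) / (d + 2) < 1 := by rw [div_lt_one (by positivity)]; linarith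
      linarith
  rw [hpow, ← Real.mul_rpow (by positivity) (by positivity),
    ← Real.mul_rpow (by positivity) (by positivity)]
  refine Real.rpow_le_rpow (by positivity) ?_ (by positivity)
  have hv : 0 < u ^ ((2 : ℝ) / (d + 2)) := Real.rpow_pos_of_pos hu0 _
  rw [hsplit]
  calc 32 * d * ℓ' / (m * D) ≤
        32 * d * ℓ / (a * (n / C * u ^ ((2 : ℝ) / (d + 2))) * D) := by gcongr
    _ = _ := by
        have : ℓ = u * n / C := by rw [hu]; field_simp
        rw [this]
        field_simp

/-- The lower bound on `m` tends to infinity, so `log(12m/δ) / m` becomes small; the upper bound is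
`o(n)`, which gives `m ≤ n` and the condition on `n / m`. The threshold depends on the law only
through constants. -/
theorem eventually_prototype_number {d : ℕ} (hd : 1 ≤ d) {a₁ a₂ δ C Ψ B : ℝ} (ha₁ : 0 < a₁)
    (hδ : 0 < δ) (hC : 0 < C) (hB : 0 < B) :
    ∃ N : ℕ, ∀ n m : ℕ, N ≤ n →
      a₁ * (((n : ℝ) / C) ^ ((d : ℝ) / (d + 2)) * Real.log (12 * n / δ) ^ ((2 : ℝ) / (d + 2))) ≤ m →
      (m : ℝ) ≤ a₂ * (((n : ℝ) / C) ^ ((d : ℝ) / (d + 2)) *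
        Real.log (12 * n / δ) ^ ((2 : ℝ) / (d + 2))) →
      1 ≤ n ∧ 3 ≤ m ∧ m ≤ n ∧ Ψ * m ≤ n ∧ 32 * d * Real.log (12 * m / δ) ≤ B * m := by
  have hd0 : (0 : ℝ) < d := by exact_mod_cast hd
  have hlog : Filter.Tendsto (fun n : ℕ => Real.log (12 * n / δ)) Filter.atTop Filter.atTop :=
    Real.tendsto_log_atTop.comp ((tendsto_natCast_atTop_atTop.const_mul_atTop
      (by norm_num : (0 : ℝ) < 12)).atTop_div_const hδ)
  have hr : Filter.Tendsto (fun n : ℕ => a₁ * (((n : ℝ) / C) ^ ((d : ℝ) / (d + 2)) *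
      Real.log (12 * n / δ) ^ ((2 : ℝ) / (d + 2)))) Filter.atTop Filter.atTop :=
    (((tendsto_rpow_atTop (by positivity)).comp
      (tendsto_natCast_atTop_atTop.atTop_div_const hC)).atTop_mul_atTop₀
      ((tendsto_rpow_atTop (by positivity)).comp hlog)).const_mul_atTop ha₁
  have hu : Filter.Tendsto (fun n : ℕ => (C * Real.log (12 * n / δ) / n) ^ ((2 : ℝ) / (d + 2)))
      Filter.atTop (nhds 0) := by
    have h1 := ((tendsto_log_div_atTop hδ).const_mul C).rpow_const
      (p := (2 : ℝ) / (d + 2)) (Or.inr (by positivity))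
    rw [mul_zero, Real.zero_rpow (by positivity)] at h1
    simpa only [mul_div_assoc] using h1
  have hu1 : ∀ κ : ℝ, ∀ᶠ n : ℕ in Filter.atTop,
      κ * (a₂ / C * (C * Real.log (12 * n / δ) / n) ^ ((2 : ℝ) / (d + 2))) < 1 := fun κ => by
    have h1 := (hu.const_mul (a₂ / C)).const_mul κ
    rw [mul_zero, mul_zero] at h1
    exact h1.eventually (gt_mem_nhds one_pos)
  have hB' : ∀ᶠ m : ℕ in Filter.atTop, Real.log (12 * m / δ) / m < B / (32 * d) :=
    (tendsto_log_div_atTop hδ).eventually (gt_mem_nhds (by positivity))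
  obtain ⟨m₀, hm₀⟩ := Filter.eventually_atTop.1 hB'
  obtain ⟨N, hN⟩ := Filter.eventually_atTop.1 ((hr.eventually_ge_atTop ((max m₀ 3 : ℕ) : ℝ)).and
    ((hu1 1).and ((hu1 (max Ψ 0)).and
      ((hlog.eventually_ge_atTop 0).and (Filter.eventually_ge_atTop 1)))))
  refine ⟨N, fun n m hn h1 h2 => ?_⟩
  obtain ⟨hr, hu1, huΨ, hℓ, hn1⟩ := hN n hn
  have hn0 : (0 : ℝ) < n := by exact_mod_cast hn1
  have hm : max m₀ 3 ≤ m := by exact_mod_cast hr.trans h1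
  have hm0 : (0 : ℝ) < m := by exact_mod_cast (by omega : 0 < m)
  rw [prototype_order_eq hn0 hC hℓ] at h2
  have h2' : (m : ℝ) ≤
      (a₂ / C * (C * Real.log (12 * n / δ) / n) ^ ((2 : ℝ) / (d + 2))) * n := by
    refine h2.trans_eq (by ring)
  refine ⟨hn1, (le_max_right _ _).trans hm, ?_, ?_, ?_⟩
  · have : (m : ℝ) ≤ n := by nlinarith
    exact_mod_cast this
  · calc Ψ * m ≤ max Ψ 0 * m := by gcongr; exact le_max_left _ _
      _ ≤ max Ψ 0 * ((a₂ / C * (C * Real.log (12 * n / δ) / n) ^ ((2 : ℝ) / (d + 2))) * n) := by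
          gcongr
      _ ≤ n := by nlinarith
  · have h3 := hm₀ m ((le_max_left _ _).trans hm)
    rw [div_lt_div_iff₀ hm0 (by positivity)] at h3
    linarith

theorem rate_bound {d : ℕ} (hd : 1 ≤ d) {n m : ℕ} (hn : 1 ≤ n) (hm : 1 ≤ m) (hmn : m ≤ n)
    {a₁ a₂ M c b δ σ Λ : ℝ} (ha₁ : 0 < a₁) (ha₂ : 0 < a₂) (hc : 0 < c) (hb : 0 < b) (hM : 0 < M)
    (hδ : 0 < δ) (hδ1 : δ < 1) (hΛ : 0 ≤ Λ)
    (h1 : a₁ * (((n : ℝ) / cDelta d δ) ^ ((d : ℝ) / (d + 2)) *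
      Real.log (12 * n / δ) ^ ((2 : ℝ) / (d + 2))) ≤ m)
    (h2 : (m : ℝ) ≤ a₂ * (((n : ℝ) / cDelta d δ) ^ ((d : ℝ) / (d + 2)) *
      Real.log (12 * n / δ) ^ ((2 : ℝ) / (d + 2)))) :
    √(4 * σ ^ 2 * psi d M c b * Real.log (1 / δ) / δ ^ d) * √((m : ℝ) / n) +
        2 * Λ * (32 * d * Real.log (12 * m / δ) / (m * b * c * unitBallVol d)) ^ ((1 : ℝ) / d) ≤
      (√a₂ + a₁⁻¹ ^ ((1 : ℝ) / d)) * (√(4 * σ ^ 2 * psi d M c b) +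
        2 * Λ * (32 * d / (b * c * unitBallVol d)) ^ ((1 : ℝ) / d)) *
          (cDelta d δ * Real.log (12 * n / δ) / n) ^ ((1 : ℝ) / (d + 2)) := by
  have hn1 : (1 : ℝ) ≤ n := by exact_mod_cast hn
  have hm1 : (1 : ℝ) ≤ m := by exact_mod_cast hm
  have hmn' : (m : ℝ) ≤ n := by exact_mod_cast hmn
  have hV := unitBallVol_pos d
  have hψ : 0 ≤ psi d M c b := by rw [psi]; positivity
  have hC : 0 < cDelta d δ :=
    div_pos (Real.log_pos (by rw [lt_div_iff₀ hδ]; linarith)) (by positivity)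
  have hℓm : 0 < Real.log (12 * m / δ) := Real.log_pos (by rw [lt_div_iff₀ hδ]; linarith)
  have hle : Real.log (12 * m / δ) ≤ Real.log (12 * n / δ) :=
    Real.log_le_log (by positivity) (by gcongr)
  have hℓ := hℓm.trans_le hle
  rw [prototype_order_eq (by linarith) hC hℓ.le] at h1 h2
  have hs1 := sqrt_term_le (s := 4 * σ ^ 2 * psi d M c b) hC ha₂ (by linarith) (by positivity)
    (by positivity) h2
  have hs2 := cover_term_le hd (D := b * c * unitBallVol d) hC ha₁ (by linarith) hℓ (by linarith)
    (by positivity) hℓm.le hle h1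
  have e1 : 4 * σ ^ 2 * psi d M c b * Real.log (1 / δ) / δ ^ d =
      4 * σ ^ 2 * psi d M c b * cDelta d δ := by rw [cDelta, mul_div_assoc]
  have e2 : (m : ℝ) * b * c * unitBallVol d = m * (b * c * unitBallVol d) := by ring
  rw [e1, e2]
  set u := (cDelta d δ * Real.log (12 * n / δ) / n) ^ ((1 : ℝ) / (d + 2))
  have hu : 0 ≤ u := by positivity
  set A := √(4 * σ ^ 2 * psi d M c b)
  set W := (32 * d / (b * c * unitBallVol d)) ^ ((1 : ℝ) / d)
  have hA : 0 ≤ A := by positivity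
  have hW : 0 ≤ W := by positivity
  set p := a₁⁻¹ ^ ((1 : ℝ) / d)
  have hp : 0 ≤ p := by positivity
  calc _ ≤ A * √a₂ * u + 2 * Λ * (W * p * u) := by gcongr
    -- Adding the nonnegative cross terms lets the constant factor out as `√a₂ + p`, which depends
    -- only on `d`, `a₁`, `a₂`.
    _ ≤ A * √a₂ * u + 2 * Λ * (W * p * u) + (A * p * u + 2 * Λ * (W * √a₂ * u)) :=
        le_add_of_nonneg_right (by positivity)
    _ = _ := by ring

end ProtoNN

theorem mainTheorem6 (d : ℕ) (hd : 1 ≤ d) :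
    -- the non-asymptotic bound
    (∀ (Ω : Type*) [MeasurableSpace Ω] (μ : Measure Ω) [IsProbabilityMeasure μ]
      (n m : ℕ) (P : Measure (ProtoNN.Cov d × ℝ)) [IsProbabilityMeasure P]
      (S : Set (ProtoNN.Cov d)) (g : ProtoNN.Cov d → ℝ)
      (X : Fin n → Ω → ProtoNN.Cov d) (Y : Fin n → Ω → ℝ) (Z : Fin m → Ω → ProtoNN.Cov d)
      (L : ℝ≥0) (σ ρ₀ T₀ c b M δ : ℝ),
      ProtoNN.Setting μ P S g X Y Z L σ ρ₀ T₀ c b M →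
      0 < δ → δ < 1 / 5 → 1 ≤ n → 3 ≤ m →
      8 * ProtoNN.psi d M c b * Real.log (1 / δ) / δ ^ d ≤ (n : ℝ) / m →
      32 * d * Real.log (12 * m / δ) ≤ T₀ ^ d * m * b * c * ProtoNN.unitBallVol d →
      ∀ x ∈ S, ∃ A : Set Ω, MeasurableSet A ∧ ENNReal.ofReal (1 - 5 * δ) ≤ μ A ∧ ∀ ω ∈ A,
        |ProtoNN.protoNN S (fun j => Z j ω) (fun i => X i ω) (fun i => Y i ω) x - g x| ≤
          √(4 * σ ^ 2 * ProtoNN.psi d M c b * Real.log (1 / δ) / δ ^ d) * √((m : ℝ) / n)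
          + 2 * ProtoNN.localLip g (ProtoNN.localCell S (fun j => Z j ω) x)
            * (32 * d * Real.log (12 * m / δ) / (m * b * c * ProtoNN.unitBallVol d))
                ^ ((1 : ℝ) / d))
    ∧
    -- the rate, for `m` of the order of `(n / c_δ)^(d/(d+2)) log(12n/δ)^(2/(d+2))`
    (∀ a₁ a₂ : ℝ, 0 < a₁ → 0 < a₂ → ∃ K : ℝ, 0 < K ∧
      ∀ T₀ c b M δ : ℝ, 0 < T₀ → 0 < c → 0 < b → b ≤ M → 0 < δ → δ < 1 / 5 →
      ∃ N : ℕ, ∀ n m : ℕ, N ≤ n →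
      a₁ * (((n : ℝ) / ProtoNN.cDelta d δ) ^ ((d : ℝ) / (d + 2))
          * Real.log (12 * n / δ) ^ ((2 : ℝ) / (d + 2))) ≤ m →
      (m : ℝ) ≤ a₂ * (((n : ℝ) / ProtoNN.cDelta d δ) ^ ((d : ℝ) / (d + 2))
          * Real.log (12 * n / δ) ^ ((2 : ℝ) / (d + 2))) →
      ∀ (Ω : Type*) [MeasurableSpace Ω] (μ : Measure Ω) [IsProbabilityMeasure μ]
        (P : Measure (ProtoNN.Cov d × ℝ)) [IsProbabilityMeasure P]
        (S : Set (ProtoNN.Cov d)) (g : ProtoNN.Cov d → ℝ)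
        (X : Fin n → Ω → ProtoNN.Cov d) (Y : Fin n → Ω → ℝ) (Z : Fin m → Ω → ProtoNN.Cov d)
        (L : ℝ≥0) (σ ρ₀ : ℝ),
        ProtoNN.Setting μ P S g X Y Z L σ ρ₀ T₀ c b M →
        ∀ x ∈ S, ∃ A : Set Ω, MeasurableSet A ∧ ENNReal.ofReal (1 - 5 * δ) ≤ μ A ∧ ∀ ω ∈ A,
          |ProtoNN.protoNN S (fun j => Z j ω) (fun i => X i ω) (fun i => Y i ω) x - g x| ≤
            K * (√(4 * σ ^ 2 * ProtoNN.psi d M c b)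
                + 2 * ProtoNN.localLip g (ProtoNN.localCell S (fun j => Z j ω) x)
                  * (32 * d / (b * c * ProtoNN.unitBallVol d)) ^ ((1 : ℝ) / d))
              * (ProtoNN.cDelta d δ * Real.log (12 * n / δ) / n) ^ ((1 : ℝ) / (d + 2))) := by
  refine ⟨?_, fun a₁ a₂ ha₁ ha₂ => ⟨√a₂ + a₁⁻¹ ^ ((1 : ℝ) / d), by positivity, ?_⟩⟩
  · intro Ω _ μ _ n m P _ S g X Y Z L σ ρ₀ T₀ c b M δ hset hδ hδ5 hn hm hnm hT x hx
    exact ProtoNN.nonasymptotic_bound hd hset hδ hδ5 hn hm hnm hT hx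
  · intro T₀ c b M δ hT₀ hc hb hbM hδ hδ5
    have hV := ProtoNN.unitBallVol_pos d
    have hC : 0 < ProtoNN.cDelta d δ :=
      div_pos (Real.log_pos (by rw [lt_div_iff₀ hδ]; linarith)) (by positivity)
    obtain ⟨N, hN⟩ := ProtoNN.eventually_prototype_number hd (a₁ := a₁) (a₂ := a₂)
      (Ψ := 8 * ProtoNN.psi d M c b * Real.log (1 / δ) / δ ^ d)
      (B := T₀ ^ d * b * c * ProtoNN.unitBallVol d) ha₁ hδ hC (by positivity)
    refine ⟨N, fun n m hn h1 h2 Ω _ μ _ P _ S g X Y Z L σ ρ₀ hset x hx => ?_⟩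
    obtain ⟨hn1, hm3, hmn, hΨ, hT⟩ := hN n m hn h1 h2
    have hm0 : (0 : ℝ) < m := by exact_mod_cast (by omega : 0 < m)
    obtain ⟨A, hA, hμA, hbound⟩ := ProtoNN.nonasymptotic_bound hd hset hδ hδ5 hn1 hm3
      ((le_div_iff₀ hm0).2 hΨ) (hT.trans_eq (by ring)) hx
    exact ⟨A, hA, hμA, fun ω hω => (hbound ω hω).trans (ProtoNN.rate_bound hd hn1 (by omega) hmn
      ha₁ ha₂ hc hb (hb.trans_le hbM) hδ (by linarith) (ProtoNN.localLip_nonneg _ _) h1 h2)⟩
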